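/- **Budget-constrained minimum cost flow ($\mathrm{BCMCFP}_{\mathbb R}$).** An instance $I$ consists of a directed multigraph $G=(V,E)$ with $n=|V|$ nodes and $m=|E|$ edges, capacities $u_e\in\mathbb{N}_{\ge 0}$, costs $c_e\in\mathbb{Z}$ and usage fees $b_e\in\mathbb{N}_{\ge 0}$ on the edges, a budget $B\in\mathbb{N}_{\ge 0}$, and nodes $s,t\in V$. A feasible flow is a vector $x\in\mathbb{R}^E$ with $0\le x_e\le u_e$ for all $e\in E$ and $\sum_{e\in\delta^-(v)}x_e-\sum_{e\in\delta^+(v)}x_e=0$ for all $v\in V\setminus\{s,t\}$. The task is to minimize $c(x)=\sum_e c_ex_e$ over the feasible flows $x$ with $b(x)=\sum_e b_ex_e\le B$. The traditional minimum cost flow problem is the same problem without fees and budget. **Model of computation.** Programs run on a random access machine with unit-cost integer arithmetic, on words whose length is at most a constant (depending only on the program) times the binary length of the largest number in the input; for the input $(I,\varepsilon)$ this includes the denominator of $\varepsilon$. Running times include $n+m$ units for input and output. An FPTAS for $\mathrm{BCMCFP}_{\mathbb R}$ is a program that, for every instance $I$ and every rational $\varepsilon\in(0,1)$, computes a feasible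 solution $x$ (rational, with a common denominator) with $c(x)\le(1-\varepsilon)\,c(x^*)$, where $x^*$ is an optimum solution, in time polynomial in the encoding size $|I|$ and $1/\varepsilon$. **Theorem.** Let $A$ be any program which computes an integral minimum cost flow in time at most $\mathrm{MCF}(m,n,C,U)$ on every instance of the traditional minimum cost flow problem with $m$ edges, $n$ nodes, $|c_e|\le C$ and $u_e\le U$. Assume that $\mathrm{MCF}(m,n,C,U)$ is bounded by a polynomial in $m$, $n$, and the binary lengths of $C$ and $U$, and that it grows at most linearly in $\log C$, i.e., there is a constant $K_0$ with $\mathrm{MCF}(m,n,C^k,U)\le K_0\,k\,\mathrm{MCF}(m,n,C,U)$ for all $m,n,U$, all $C\ge 2$ and all $k\ge 1$. Then there is an FPTAS for $\mathrm{BCMCFP}_{\mathbb R}$ that runs in $$\mathcal{O}\!\left(\left(\frac{\log M}{\varepsilon}\right)^{2}\cdot \mathrm{MCF}(m,n,C,U)\right)$$ time, where $C\ge 2$, $U$ and $M\ge 2$ are arbitrary upper bounds on the largest absolute cost $|c_e|$, on the largest capacity, and on the largest absolute value of any number in $I$ (including $n$ and $m$), respectively. The constant in the $\mathcal{O}$-notation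 depends only on $A$ and the function $\mathrm{MCF}$. -/

import Mathlib

open Finset

namespace BCFlow

/-! ### Networks and flows -/

/-- An instance of the traditional minimum cost flow problem: a directed multigraph with node set
`Fin n` and edge set `Fin m` (parallel edges and loops are allowed), integral capacities `≥ 0`,
integral costs of arbitrary sign, a source and a sink. -/
structure MCFInstance where
  n : ℕ
  m : ℕ
  tail : Fin m → Fin n
  head : Fin m → Fin n
  cap : Fin m → ℕ
  cost : Fin m → ℤ
  source : Fin n
  sink : Fin n

/-- An instance of the budget-constrained minimum cost flow problem: in addition, there are
usage fees on the edges and a budget. -/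
structure BCInstance extends MCFInstance where
  fee : Fin m → ℕ
  budget : ℕ

namespace MCFInstance

variable (I : MCFInstance)

/-- `x` is a feasible (real-valued) `s`-`t`-flow: it is conserved at every node other than the
source and the sink, and it respects the capacities. -/
def IsFlow (x : Fin I.m → ℝ) : Prop :=
  (∀ v : Fin I.n, v ≠ I.source → v ≠ I.sink →
    (∑ e with I.head e = v, x e) - (∑ e with I.tail e = v, x e) = 0) ∧
  ∀ e, 0 ≤ x e ∧ x e ≤ (I.cap e : ℝ)

/-- The total cost `c(x)`. -/
def totalCost (x : Fin I.m → ℝ) : ℝ := ∑ e, (I.cost e : ℝ) * x e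

/-- `x` is a minimum cost flow. -/
def IsMinCostFlow (x : Fin I.m → ℝ) : Prop :=
  I.IsFlow x ∧ ∀ y, I.IsFlow y → I.totalCost x ≤ I.totalCost y

/-- The largest absolute value of a cost. -/
def maxCost : ℕ := univ.sup fun e => (I.cost e).natAbs

/-- The largest capacity. -/
def maxCap : ℕ := univ.sup fun e => I.cap e

/-- The largest absolute value of a number in the input (the numbers of nodes and of edges are
part of the input). -/
def maxNum : ℕ := max (max I.n I.m) (max I.maxCost I.maxCap)

end MCFInstance

namespace BCInstance

variable (I : BCInstance)

/-- The total usage fee `b(x)`. -/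
def totalFee (x : Fin I.m → ℝ) : ℝ := ∑ e, (I.fee e : ℝ) * x e

/-- `x` is a feasible solution: a feasible flow that obeys the budget constraint. -/
def IsFeasible (x : Fin I.m → ℝ) : Prop :=
  I.IsFlow x ∧ I.totalFee x ≤ (I.budget : ℝ)

/-- `x` is an optimum solution. -/
def IsOptimal (x : Fin I.m → ℝ) : Prop :=
  I.IsFeasible x ∧ ∀ y, I.IsFeasible y → I.totalCost x ≤ I.totalCost y

/-- The largest usage fee. -/
def maxFee : ℕ := univ.sup fun e => I.fee e

/-- The largest absolute value of a number in the input (the numbers of nodes and of edges are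
part of the input). -/
def maxNum : ℕ := max I.toMCFInstance.maxNum (max I.maxFee I.budget)

/-- The encoding size `|I|`: one unit for each node and each edge, and the binary lengths of the
numbers that describe the edges, the source, the sink and the budget. -/
def encodingSize : ℕ :=
  I.n + Nat.size I.source + Nat.size I.sink + Nat.size I.budget +
    ∑ e, (1 + Nat.size (I.tail e) + Nat.size (I.head e) + Nat.size (I.cap e) +
      Nat.size (I.cost e).natAbs + Nat.size (I.fee e))

end BCInstance

/-! ### The machine model

A random access machine with words of `w` bits, programmed in a structured language. A program
uses finitely many arrays; array names are natural numbers, fixed in the program, while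
the index of an access is computed. Every elementary operation takes one time step, and it may be
carried out only if the numbers involved fit into a word. -/

/-- The memory: `σ a i` is the content of cell `i` of array `a`. -/
abbrev Mem : Type := ℕ → ℤ → ℤ

/-- Arithmetic expressions: constants, array accesses, and the four operations, where `div` is
integer division. -/
inductive Exp : Type
  | const (z : ℤ) : Exp
  | read (a : ℕ) (i : Exp) : Exp
  | add (p q : Exp) : Exp
  | sub (p q : Exp) : Exp
  | mul (p q : Exp) : Exp
  | div (p q : Exp) : Exp

namespace Exp

/-- The value of an expression. -/
def eval (σ : Mem) : Exp → ℤ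
  | const z => z
  | read a i => σ a (i.eval σ)
  | add p q => p.eval σ + q.eval σ
  | sub p q => p.eval σ - q.eval σ
  | mul p q => p.eval σ * q.eval σ
  | div p q => p.eval σ / q.eval σ

/-- The number of steps that evaluating an expression takes. -/
def steps : Exp → ℕ
  | const _ => 1
  | read _ i => i.steps + 1
  | add p q => p.steps + q.steps + 1
  | sub p q => p.steps + q.steps + 1
  | mul p q => p.steps + q.steps + 1
  | div p q => p.steps + q.steps + 1

/-- The values of the expression and of all its subexpressions fit into words of `w` bits
(plus sign). -/
def Fits (w : ℕ) (σ : Mem) : Exp → Prop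
  | const z => |z| < 2 ^ w
  | read a i => i.Fits w σ ∧ |(read a i).eval σ| < 2 ^ w
  | add p q => p.Fits w σ ∧ q.Fits w σ ∧ |(add p q).eval σ| < 2 ^ w
  | sub p q => p.Fits w σ ∧ q.Fits w σ ∧ |(sub p q).eval σ| < 2 ^ w
  | mul p q => p.Fits w σ ∧ q.Fits w σ ∧ |(mul p q).eval σ| < 2 ^ w
  | div p q => p.Fits w σ ∧ q.Fits w σ ∧ |(div p q).eval σ| < 2 ^ w

end Exp

/-- Programs.
* `assign a i p`: write the value of `p` into cell `i` of array `a`;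
* `reset a`: replace array `a` by a new one, all of whose cells are zero (the cost of erasing a
  cell is paid for by the step that wrote it);
* `seq P Q`: first `P`, then `Q`;
* `ite p P Q`: if the value of `p` is positive then `P`, else `Q`;
* `loop p P`: while the value of `p` is positive, `P`. -/
inductive Prog : Type
  | assign (a : ℕ) (i p : Exp) : Prog
  | reset (a : ℕ) : Prog
  | seq (P Q : Prog) : Prog
  | ite (p : Exp) (P Q : Prog) : Prog
  | loop (p : Exp) (P : Prog) : Prog

/-- `Exec w P σ k τ`: on a machine with words of `w` bits, the program `P`, started with memory `σ`,
halts after `k` steps with memory `τ`. -/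
inductive Exec (w : ℕ) : Prog → Mem → ℕ → Mem → Prop
  | assign (a : ℕ) (i p : Exp) (σ : Mem) (hi : i.Fits w σ) (hp : p.Fits w σ) :
      Exec w (.assign a i p) σ (i.steps + p.steps + 1)
        (Function.update σ a (Function.update (σ a) (i.eval σ) (p.eval σ)))
  | reset (a : ℕ) (σ : Mem) : Exec w (.reset a) σ 1 (Function.update σ a 0)
  | seq (P Q : Prog) (σ₁ σ₂ σ₃ : Mem) (k l : ℕ) (hP : Exec w P σ₁ k σ₂) (hQ : Exec w Q σ₂ l σ₃) :
      Exec w (.seq P Q) σ₁ (k + l) σ₃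
  | ite_pos (p : Exp) (P Q : Prog) (σ τ : Mem) (k : ℕ) (hp : p.Fits w σ) (h : 0 < p.eval σ)
      (hP : Exec w P σ k τ) : Exec w (.ite p P Q) σ (p.steps + 1 + k) τ
  | ite_neg (p : Exp) (P Q : Prog) (σ τ : Mem) (k : ℕ) (hp : p.Fits w σ) (h : p.eval σ ≤ 0)
      (hQ : Exec w Q σ k τ) : Exec w (.ite p P Q) σ (p.steps + 1 + k) τ
  | loop_stop (p : Exp) (P : Prog) (σ : Mem) (hp : p.Fits w σ) (h : p.eval σ ≤ 0) :
      Exec w (.loop p P) σ (p.steps + 1) σ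
  | loop_step (p : Exp) (P : Prog) (σ₁ σ₂ σ₃ : Mem) (k l : ℕ) (hp : p.Fits w σ₁)
      (h : 0 < p.eval σ₁) (hP : Exec w P σ₁ k σ₂) (hL : Exec w (.loop p P) σ₂ l σ₃) :
      Exec w (.loop p P) σ₁ (p.steps + 1 + k + l) σ₃

/-! ### Input and output -/

/-- The array that holds the list `l` in its cells `0, 1, …` and is zero elsewhere. -/
def arrayOf (l : List ℤ) : ℤ → ℤ := fun i => if 0 ≤ i then l.getD i.toNat 0 else 0

/-- The initial memory for an instance of the minimum cost flow problem. -/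
def MCFInstance.input (I : MCFInstance) : Mem
  | 0 => arrayOf [(I.n : ℤ), (I.m : ℤ), ((I.source : ℕ) : ℤ), ((I.sink : ℕ) : ℤ)]
  | 1 => arrayOf (List.ofFn fun e => ((I.tail e : ℕ) : ℤ))
  | 2 => arrayOf (List.ofFn fun e => ((I.head e : ℕ) : ℤ))
  | 3 => arrayOf (List.ofFn fun e => (I.cap e : ℤ))
  | 4 => arrayOf (List.ofFn fun e => I.cost e)
  | _ => 0

/-- The initial memory for an instance of the budget-constrained problem and an accuracy `ε`, which
is given by its numerator and its denominator. -/
def BCInstance.input (I : BCInstance) (ε : ℚ) : Mem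
  | 0 => arrayOf [(I.n : ℤ), (I.m : ℤ), ((I.source : ℕ) : ℤ), ((I.sink : ℕ) : ℤ),
      (I.budget : ℤ), ε.num, (ε.den : ℤ)]
  | 1 => arrayOf (List.ofFn fun e => ((I.tail e : ℕ) : ℤ))
  | 2 => arrayOf (List.ofFn fun e => ((I.head e : ℕ) : ℤ))
  | 3 => arrayOf (List.ofFn fun e => (I.cap e : ℤ))
  | 4 => arrayOf (List.ofFn fun e => I.cost e)
  | 5 => arrayOf (List.ofFn fun e => (I.fee e : ℤ))
  | _ => 0

/-- The integral vector in the output array `6`. -/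
def intOutput (m : ℕ) (τ : Mem) : Fin m → ℝ := fun e => (τ 6 ((e : ℕ) : ℤ) : ℝ)

/-- The rational vector with numerators in the output array `6` and common denominator
in cell `0` of array `7`. -/
noncomputable def ratOutput (m : ℕ) (τ : Mem) : Fin m → ℝ :=
  fun e => (τ 6 ((e : ℕ) : ℤ) : ℝ) / (τ 7 0 : ℝ)

/-! ### Algorithms and their running times

Running times include `n + m` time units for the input and the output. Words have a number of bits
that is proportional to the binary length of the largest number in the input. -/

/-- The program `A` solves the traditional minimum cost flow problem in time `T m n C U`: on every
instance with `m` edges, `n` nodes, absolute costs at most `C` and capacities at most `U`, it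
computes an (integral) minimum cost flow within this time. -/
def SolvesMCF (A : Prog) (T : ℕ → ℕ → ℕ → ℕ → ℝ) : Prop :=
  ∃ κ : ℕ, ∀ (I : MCFInstance) (C U : ℕ), I.maxCost ≤ C → I.maxCap ≤ U →
    ∃ (k : ℕ) (τ : Mem), Exec (κ * Nat.size I.maxNum) A I.input k τ ∧
      ((I.n + I.m + k : ℕ) : ℝ) ≤ T I.m I.n C U ∧
      I.IsMinCostFlow (intOutput I.m τ)

/-- The time bound `T m n C U` is (weakly) polynomial. -/
def PolynomiallyBounded (T : ℕ → ℕ → ℕ → ℕ → ℝ) : Prop :=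
  ∃ d : ℕ, ∀ m n C U : ℕ,
    T m n C U ≤ ((d * (m + n + Nat.size C + Nat.size U + 1) ^ d : ℕ) : ℝ)

/-- The time bound `T m n C U` grows at most linearly in `log C`, up to a constant factor:
raising `C` to the power `k` multiplies it by `O(k)`. -/
def AtMostLinearInLogCost (T : ℕ → ℕ → ℕ → ℕ → ℝ) : Prop :=
  ∃ K : ℝ, ∀ m n C U k : ℕ, 2 ≤ C → 1 ≤ k → T m n (C ^ k) U ≤ K * k * T m n C U

/-- `Q`, with words of length `K` times the binary length of the largest number in the input, takes
time at most `t` on the input `(I, ε)` and computes a feasible solution `x` with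
`c(x) ≤ (1 - ε) c(x*)` for an optimum solution `x*`. -/
def ApproximatesWithin (Q : Prog) (K : ℕ) (I : BCInstance) (ε : ℚ) (t : ℝ) : Prop :=
  ∃ (k : ℕ) (τ : Mem), Exec (K * Nat.size (I.maxNum + ε.den)) Q (I.input ε) k τ ∧
    ((I.n + I.m + k : ℕ) : ℝ) ≤ t ∧
    0 < τ 7 0 ∧ I.IsFeasible (ratOutput I.m τ) ∧
    ∃ xopt, I.IsOptimal xopt ∧ I.totalCost (ratOutput I.m τ) ≤ (1 - (ε : ℝ)) * I.totalCost xopt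

/-- `Q` is a fully polynomial-time approximation scheme: its running time is bounded by
a polynomial in `|I|` and `1 / ε`. -/
def IsFPTAS (Q : Prog) : Prop :=
  ∃ K d : ℕ, ∀ (I : BCInstance) (ε : ℚ), 0 < ε → ε < 1 →
    ApproximatesWithin Q K I ε (d * ((I.encodingSize : ℝ) + 1 / (ε : ℝ)) ^ d)

/-- `Q` is an approximation scheme with running time `O(f I ε M C U)`, where `C`, `U` and `M` are
any upper bounds (with `C, M ≥ 2`) on the largest absolute cost, on the largest capacity and on
the largest absolute value of any number in the input. -/
def RunsInBigO (Q : Prog) (f : BCInstance → ℚ → ℕ → ℕ → ℕ → ℝ) : Prop :=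
  ∃ K : ℕ, ∀ (I : BCInstance) (ε : ℚ) (M C U : ℕ), 0 < ε → ε < 1 →
    2 ≤ M → I.maxNum ≤ M → 2 ≤ C → I.maxCost ≤ C → I.maxCap ≤ U →
    ApproximatesWithin Q K I ε (K * f I ε M C U)

end BCFlow

open BCFlow

/-!
Since the zero flow is feasible and free, the optimum value is at most `0`; hence an exact optimum
`x` satisfies `c(x) ≤ (1 - ε) c(x)` for every `ε > 0`. The hypothesis that the running time of the
minimum cost flow program grows at most linearly in `log C` makes an exact optimum affordable
within the time allowed, so the scheme below ignores `ε`.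

The scheme is a binary search for the Lagrange multiplier of the budget constraint. For a
multiplier `p / q`, the relaxation is a minimum cost flow problem with the integral costs
`q c_e + p b_e`, which the given program `A` solves by an integral flow. The search keeps two
multipliers `lo / q < hi / q`, with a minimizer `x` for the first that exceeds the budget and
a minimizer `y` for the second that obeys it. The denominator `q` is chosen larger than the square
of a bound on the fees of flows. When `hi = lo + 1`, consider the multiplier at which `x` and `y`
have the same Lagrangian value. Integral flows have, at this multiplier, Lagrangian values that are
multiples of `1 / (b(x) - b(y))`, and the distance to `lo / q` is too small for any such flow to
undercut `x` (`BCInstance.lagrangian_le_of_consecutive`). So `x` and `y` are both minimizers there,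
and by Lagrangian duality the convex combination of them that exhausts the budget is optimal
(`BCInstance.isOptimal_combo`). That the relaxations have integral minimizers need not be proved
separately: `A` computes them.

All numbers that are stored are less than `Y ^ 16`, where `Y = 2 ^ s` and `s` is the binary length
of the largest number in the instance (`BCInstance.derived_le`). Hence the search takes `O(s)`
iterations (`runs_search`), and each of them takes `O(MCF(m, n, C ^ (16 s), U)) = O(s MCF(m, n, C, U))` steps.
As `s = O(log M)`, this gives the time bound (`exists_scheme`, `exists_runsInBigO`).

On the machine, the scheme keeps its data in arrays that `A` does not name; `A` neither reads nor
changes them (`Exec.frame`), so that `A`, run in the midst of the scheme, behaves as on its own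
input.
-/

namespace BCFlow

/-! ### Executions with a time bound -/

/-- `P`, started with memory `σ`, halts within `t` steps with memory `τ`. -/
def Runs (w : ℕ) (P : Prog) (σ : Mem) (t : ℕ) (τ : Mem) : Prop :=
  ∃ k ≤ t, Exec w P σ k τ

theorem Runs.mono_time {w : ℕ} {P : Prog} {σ τ : Mem} {t t' : ℕ} (h : Runs w P σ t τ)
    (ht : t ≤ t') : Runs w P σ t' τ :=
  let ⟨k, hk, hx⟩ := h
  ⟨k, hk.trans ht, hx⟩

theorem Runs.seq {w : ℕ} {P Q : Prog} {σ₁ σ₂ σ₃ : Mem} {s t : ℕ} (hP : Runs w P σ₁ s σ₂)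
    (hQ : Runs w Q σ₂ t σ₃) : Runs w (.seq P Q) σ₁ (s + t) σ₃ :=
  let ⟨_, hk, hx⟩ := hP
  let ⟨_, hl, hy⟩ := hQ
  ⟨_, Nat.add_le_add hk hl, .seq _ _ _ _ _ _ _ hx hy⟩

theorem Runs.ite_pos {w : ℕ} {p : Exp} {P Q : Prog} {σ τ : Mem} {t : ℕ} (hp : p.Fits w σ)
    (h : 0 < p.eval σ) (hP : Runs w P σ t τ) : Runs w (.ite p P Q) σ (p.steps + 1 + t) τ :=
  let ⟨_, hk, hx⟩ := hP
  ⟨_, Nat.add_le_add_left hk _, .ite_pos _ _ _ _ _ _ hp h hx⟩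

theorem Runs.ite_neg {w : ℕ} {p : Exp} {P Q : Prog} {σ τ : Mem} {t : ℕ} (hp : p.Fits w σ)
    (h : p.eval σ ≤ 0) (hQ : Runs w Q σ t τ) : Runs w (.ite p P Q) σ (p.steps + 1 + t) τ :=
  let ⟨_, hk, hx⟩ := hQ
  ⟨_, Nat.add_le_add_left hk _, .ite_neg _ _ _ _ _ _ hp h hx⟩

theorem Runs.loop_stop {w : ℕ} {p : Exp} {P : Prog} {σ : Mem} (hp : p.Fits w σ)
    (h : p.eval σ ≤ 0) : Runs w (.loop p P) σ (p.steps + 1) σ :=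
  ⟨_, le_rfl, Exec.loop_stop _ _ _ hp h⟩

theorem Runs.loop_step {w : ℕ} {p : Exp} {P : Prog} {σ₁ σ₂ σ₃ : Mem} {s t : ℕ}
    (hp : p.Fits w σ₁) (h : 0 < p.eval σ₁) (hP : Runs w P σ₁ s σ₂)
    (hL : Runs w (.loop p P) σ₂ t σ₃) : Runs w (.loop p P) σ₁ (p.steps + 1 + s + t) σ₃ :=
  let ⟨_, hk, hx⟩ := hP
  let ⟨_, hl, hy⟩ := hL
  ⟨_, Nat.add_le_add (Nat.add_le_add_left hk _) hl, .loop_step _ _ _ _ _ _ _ hp h hx hy⟩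

/-- The memory `σ` after `v` has been written into cell `j` of array `a`. -/
def write (σ : Mem) (a : ℕ) (j v : ℤ) : Mem :=
  Function.update σ a (Function.update (σ a) j v)

theorem write_same (σ : Mem) (a : ℕ) (j v : ℤ) :
    write σ a j v a = Function.update (σ a) j v := by simp [write]

theorem write_of_ne (σ : Mem) {a b : ℕ} (j v : ℤ) (h : b ≠ a) : write σ a j v b = σ b := by
  simp [write, h]

theorem write_cell (σ : Mem) (a : ℕ) (j v : ℤ) : write σ a j v a j = v := by simp [write]

theorem Runs.assign {w : ℕ} {a : ℕ} {i p : Exp} {σ : Mem} (hi : i.Fits w σ) (hp : p.Fits w σ) :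
    Runs w (.assign a i p) σ (i.steps + p.steps + 1) (write σ a (i.eval σ) (p.eval σ)) :=
  ⟨_, le_rfl, .assign _ _ _ _ hi hp⟩

/-! ### Longer words -/

theorem Exp.Fits.mono {w w' : ℕ} (hw : w ≤ w') {σ : Mem} {p : Exp} (h : p.Fits w σ) :
    p.Fits w' σ := by
  have h2 : (2 : ℤ) ^ w ≤ 2 ^ w' := pow_le_pow_right₀ (by norm_num) hw
  induction p with
  | const z => exact lt_of_lt_of_le h h2
  | read a i hi => exact ⟨hi h.1, lt_of_lt_of_le h.2 h2⟩
  | add p q hp hq => exact ⟨hp h.1, hq h.2.1, lt_of_lt_of_le h.2.2 h2⟩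
  | sub p q hp hq => exact ⟨hp h.1, hq h.2.1, lt_of_lt_of_le h.2.2 h2⟩
  | mul p q hp hq => exact ⟨hp h.1, hq h.2.1, lt_of_lt_of_le h.2.2 h2⟩
  | div p q hp hq => exact ⟨hp h.1, hq h.2.1, lt_of_lt_of_le h.2.2 h2⟩

theorem Exec.mono {w w' : ℕ} (hw : w ≤ w') {P : Prog} {σ τ : Mem} {k : ℕ}
    (h : Exec w P σ k τ) : Exec w' P σ k τ := by
  induction h with
  | assign a i p σ hi hp => exact .assign _ _ _ _ (hi.mono hw) (hp.mono hw)
  | reset a σ => exact .reset _ _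
  | seq P Q _ _ _ _ _ _ _ h₁ h₂ => exact .seq _ _ _ _ _ _ _ h₁ h₂
  | ite_pos p P Q _ _ _ hp h _ ih => exact .ite_pos _ _ _ _ _ _ (hp.mono hw) h ih
  | ite_neg p P Q _ _ _ hp h _ ih => exact .ite_neg _ _ _ _ _ _ (hp.mono hw) h ih
  | loop_stop p P _ hp h => exact Exec.loop_stop _ _ _ (hp.mono hw) h
  | loop_step p P _ _ _ _ _ hp h _ _ h₁ h₂ =>
    exact .loop_step _ _ _ _ _ _ _ (hp.mono hw) h h₁ h₂

/-! ### Programs touch only the arrays that they name -/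

/-- All arrays that the expression names are among the arrays `0, …, D - 1`. -/
def Exp.Below (D : ℕ) : Exp → Prop
  | .const _ => True
  | .read a i => a < D ∧ i.Below D
  | .add p q => p.Below D ∧ q.Below D
  | .sub p q => p.Below D ∧ q.Below D
  | .mul p q => p.Below D ∧ q.Below D
  | .div p q => p.Below D ∧ q.Below D

/-- All arrays that the program names are among the arrays `0, …, D - 1`. -/
def Prog.Below (D : ℕ) : Prog → Prop
  | .assign a i p => a < D ∧ i.Below D ∧ p.Below D
  | .reset a => a < D
  | .seq P Q => P.Below D ∧ Q.Below D
  | .ite p P Q => p.Below D ∧ P.Below D ∧ Q.Below D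
  | .loop p P => p.Below D ∧ P.Below D

theorem Exp.Below.mono {D D' : ℕ} (hD : D ≤ D') {p : Exp} (h : p.Below D) : p.Below D' := by
  induction p with
  | const z => trivial
  | read a i hi => exact ⟨h.1.trans_le hD, hi h.2⟩
  | add p q hp hq => exact ⟨hp h.1, hq h.2⟩
  | sub p q hp hq => exact ⟨hp h.1, hq h.2⟩
  | mul p q hp hq => exact ⟨hp h.1, hq h.2⟩
  | div p q hp hq => exact ⟨hp h.1, hq h.2⟩

theorem Prog.Below.mono {D D' : ℕ} (hD : D ≤ D') {P : Prog} (h : P.Below D) : P.Below D' := by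
  induction P with
  | assign a i p => exact ⟨h.1.trans_le hD, h.2.1.mono hD, h.2.2.mono hD⟩
  | reset a => exact Nat.lt_of_lt_of_le h hD
  | seq P Q hP hQ => exact ⟨hP h.1, hQ h.2⟩
  | ite p P Q hP hQ => exact ⟨h.1.mono hD, hP h.2.1, hQ h.2.2⟩
  | loop p P hP => exact ⟨h.1.mono hD, hP h.2⟩

theorem Exp.exists_below (p : Exp) : ∃ D, p.Below D := by
  induction p with
  | const z => exact ⟨0, trivial⟩
  | read a i hi =>
    obtain ⟨D, hD⟩ := hi
    exact ⟨max (a + 1) D, by omega, hD.mono (le_max_right _ _)⟩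
  | add p q hp hq | sub p q hp hq | mul p q hp hq | div p q hp hq =>
    obtain ⟨D, hD⟩ := hp
    obtain ⟨D', hD'⟩ := hq
    exact ⟨max D D', hD.mono (le_max_left _ _), hD'.mono (le_max_right _ _)⟩

theorem Prog.exists_below (P : Prog) : ∃ D, P.Below D := by
  induction P with
  | assign a i p =>
    obtain ⟨D, hD⟩ := i.exists_below
    obtain ⟨D', hD'⟩ := p.exists_below
    exact ⟨max (a + 1) (max D D'), by omega, hD.mono (by omega), hD'.mono (by omega)⟩
  | reset a => exact ⟨a + 1, Nat.lt_succ_self a⟩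
  | seq P Q hP hQ =>
    obtain ⟨D, hD⟩ := hP
    obtain ⟨D', hD'⟩ := hQ
    exact ⟨max D D', hD.mono (le_max_left _ _), hD'.mono (le_max_right _ _)⟩
  | ite p P Q hP hQ =>
    obtain ⟨D₀, hD₀⟩ := p.exists_below
    obtain ⟨D, hD⟩ := hP
    obtain ⟨D', hD'⟩ := hQ
    exact ⟨max D₀ (max D D'), hD₀.mono (by omega), hD.mono (by omega), hD'.mono (by omega)⟩
  | loop p P hP =>
    obtain ⟨D₀, hD₀⟩ := p.exists_below
    obtain ⟨D, hD⟩ := hP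
    exact ⟨max D₀ D, hD₀.mono (by omega), hD.mono (by omega)⟩

theorem Exp.Below.eval_congr {D : ℕ} {σ σ' : Mem} (hσ : ∀ a < D, σ' a = σ a) {p : Exp}
    (h : p.Below D) : p.eval σ' = p.eval σ := by
  induction p with
  | const z => rfl
  | read a i hi => simp only [Exp.eval, hi h.2, hσ a h.1]
  | add p q hp hq | sub p q hp hq | mul p q hp hq | div p q hp hq =>
    simp only [Exp.eval, hp h.1, hq h.2]

theorem Exp.Below.fits_congr {D w : ℕ} {σ σ' : Mem} (hσ : ∀ a < D, σ' a = σ a) {p : Exp}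
    (h : p.Below D) (hf : p.Fits w σ) : p.Fits w σ' := by
  have he := h.eval_congr hσ
  induction p with
  | const z => exact hf
  | read a i hi => exact ⟨hi h.2 hf.1 (h.2.eval_congr hσ), by rw [he]; exact hf.2⟩
  | add p q hp hq | sub p q hp hq | mul p q hp hq | div p q hp hq =>
    exact ⟨hp h.1 hf.1 (h.1.eval_congr hσ), hq h.2 hf.2.1 (h.2.eval_congr hσ),
      by rw [he]; exact hf.2.2⟩

/-- A program neither reads nor changes the arrays that it does not name. -/
theorem Exec.frame {D w : ℕ} {P : Prog} {σ τ : Mem} {k : ℕ} (h : Exec w P σ k τ)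
    (hP : P.Below D) {σ' : Mem} (hσ : ∀ a < D, σ' a = σ a) :
    ∃ τ', Exec w P σ' k τ' ∧ (∀ a < D, τ' a = τ a) ∧ ∀ a, D ≤ a → τ' a = σ' a := by
  induction h generalizing σ' with
  | assign a i p σ hi hp =>
    refine ⟨_, .assign _ _ _ _ (hP.2.1.fits_congr hσ hi) (hP.2.2.fits_congr hσ hp), ?_, ?_⟩
    · intro b hb
      rw [hP.2.1.eval_congr hσ, hP.2.2.eval_congr hσ, hσ a hP.1]
      by_cases hba : b = a
      · subst hba; simp
      · simp [hba, hσ b hb]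
    · intro b hb
      have := hP.1
      rw [Function.update_of_ne (by omega)]
  | reset a σ =>
    refine ⟨_, .reset _ _, ?_, ?_⟩
    · intro b hb
      by_cases hba : b = a
      · subst hba; simp
      · simp [hba, hσ b hb]
    · intro b hb
      have : a < D := hP
      rw [Function.update_of_ne (by omega)]
  | seq P Q _ _ _ _ _ _ _ h₁ h₂ =>
    obtain ⟨τ₁, hx₁, ha₁, hf₁⟩ := h₁ hP.1 hσ
    obtain ⟨τ₂, hx₂, ha₂, hf₂⟩ := h₂ hP.2 ha₁
    exact ⟨τ₂, .seq _ _ _ _ _ _ _ hx₁ hx₂, ha₂, fun a ha => (hf₂ a ha).trans (hf₁ a ha)⟩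
  | ite_pos p P Q _ _ _ hp h _ ih =>
    obtain ⟨τ₁, hx₁, ha₁, hf₁⟩ := ih hP.2.1 hσ
    exact ⟨τ₁, .ite_pos _ _ _ _ _ _ (hP.1.fits_congr hσ hp) (by rwa [hP.1.eval_congr hσ]) hx₁,
      ha₁, hf₁⟩
  | ite_neg p P Q _ _ _ hp h _ ih =>
    obtain ⟨τ₁, hx₁, ha₁, hf₁⟩ := ih hP.2.2 hσ
    exact ⟨τ₁, .ite_neg _ _ _ _ _ _ (hP.1.fits_congr hσ hp) (by rwa [hP.1.eval_congr hσ]) hx₁,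
      ha₁, hf₁⟩
  | loop_stop p P _ hp h =>
    exact ⟨σ', Exec.loop_stop _ _ _ (hP.1.fits_congr hσ hp) (by rwa [hP.1.eval_congr hσ]), hσ,
      fun _ _ => rfl⟩
  | loop_step p P _ _ _ _ _ hp h _ _ h₁ h₂ =>
    obtain ⟨τ₁, hx₁, ha₁, hf₁⟩ := h₁ hP.2 hσ
    obtain ⟨τ₂, hx₂, ha₂, hf₂⟩ := h₂ hP ha₁
    exact ⟨τ₂, .loop_step _ _ _ _ _ _ _ (hP.1.fits_congr hσ hp) (by rwa [hP.1.eval_congr hσ])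
      hx₁ hx₂, ha₂, fun a ha => (hf₂ a ha).trans (hf₁ a ha)⟩

/-! ### Word lengths by degree -/

/-- An upper bound on the exponent by which evaluation can raise a bound on the constants and the
cells that the expression reads; an addition counts for one. -/
def Exp.deg : Exp → ℕ
  | .const _ => 1
  | .read _ i => max i.deg 1
  | .add p q => max p.deg q.deg + 1
  | .sub p q => max p.deg q.deg + 1
  | .mul p q => p.deg + q.deg
  | .div p q => max p.deg q.deg

/-- The constants of the expression and the contents of the cells that it reads are less than `R`
in absolute value. -/
def Exp.AtomsLt (R : ℤ) (σ : Mem) : Exp → Prop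
  | .const z => |z| < R
  | .read a i => i.AtomsLt R σ ∧ |σ a (i.eval σ)| < R
  | .add p q => p.AtomsLt R σ ∧ q.AtomsLt R σ
  | .sub p q => p.AtomsLt R σ ∧ q.AtomsLt R σ
  | .mul p q => p.AtomsLt R σ ∧ q.AtomsLt R σ
  | .div p q => p.AtomsLt R σ ∧ q.AtomsLt R σ

theorem Exp.AtomsLt.abs_eval_lt {R : ℤ} (hR : 2 ≤ R) {σ : Mem} {p : Exp} (h : p.AtomsLt R σ) :
    |p.eval σ| < R ^ p.deg := by
  have hmono : ∀ {i j : ℕ}, i ≤ j → R ^ i ≤ R ^ j := fun hij =>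
    pow_le_pow_right₀ (by omega) hij
  induction p with
  | const z => simpa [Exp.deg, Exp.eval, Exp.AtomsLt] using h
  | read a i hi =>
    refine lt_of_lt_of_le h.2 ?_
    calc R = R ^ 1 := (pow_one R).symm
      _ ≤ R ^ (Exp.read a i).deg := hmono (le_max_right _ _)
  | add p q hp hq =>
    have h1 := (hp h.1).trans_le (hmono (le_max_left p.deg q.deg))
    have h2 := (hq h.2).trans_le (hmono (le_max_right p.deg q.deg))
    simp only [Exp.eval, Exp.deg, pow_succ]
    have := abs_add_le (p.eval σ) (q.eval σ)
    have := abs_nonneg (p.eval σ)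
    nlinarith
  | sub p q hp hq =>
    have h1 := (hp h.1).trans_le (hmono (le_max_left p.deg q.deg))
    have h2 := (hq h.2).trans_le (hmono (le_max_right p.deg q.deg))
    simp only [Exp.eval, Exp.deg, pow_succ]
    have := abs_sub (p.eval σ) (q.eval σ)
    have := abs_nonneg (p.eval σ)
    nlinarith
  | mul p q hp hq =>
    simp only [Exp.eval, Exp.deg, pow_add, abs_mul]
    exact mul_lt_mul'' (hp h.1) (hq h.2) (abs_nonneg _) (abs_nonneg _)
  | div p q hp hq =>
    have h1 := (hp h.1).trans_le (hmono (le_max_left p.deg q.deg))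
    refine lt_of_le_of_lt ?_ h1
    simp only [Exp.eval]
    rw [← Int.natCast_natAbs, ← Int.natCast_natAbs]
    exact_mod_cast Int.natAbs_ediv_le_natAbs _ _

theorem Exp.AtomsLt.fits {R : ℤ} (hR : 2 ≤ R) {σ : Mem} {p : Exp} {w : ℕ}
    (h : p.AtomsLt R σ) (hw : R ^ p.deg ≤ 2 ^ w) : p.Fits w σ := by
  have hmono : ∀ {i j : ℕ}, i ≤ j → R ^ i ≤ R ^ j := fun hij =>
    pow_le_pow_right₀ (by omega) hij
  have he := (h.abs_eval_lt hR).trans_le hw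
  induction p with
  | const z => exact he
  | read a i hi =>
    have hw' := (hmono (le_max_left i.deg 1)).trans hw
    exact ⟨hi h.1 hw' ((h.1.abs_eval_lt hR).trans_le hw'), he⟩
  | add p q hp hq | sub p q hp hq =>
    have h1 := (hmono ((le_max_left p.deg q.deg).trans (Nat.le_succ _))).trans hw
    have h2 := (hmono ((le_max_right p.deg q.deg).trans (Nat.le_succ _))).trans hw
    exact ⟨hp h.1 h1 ((h.1.abs_eval_lt hR).trans_le h1),
      hq h.2 h2 ((h.2.abs_eval_lt hR).trans_le h2), he⟩
  | mul p q hp hq =>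
    have h1 := (hmono (Nat.le_add_right p.deg q.deg)).trans hw
    have h2 := (hmono (Nat.le_add_left q.deg p.deg)).trans hw
    exact ⟨hp h.1 h1 ((h.1.abs_eval_lt hR).trans_le h1),
      hq h.2 h2 ((h.2.abs_eval_lt hR).trans_le h2), he⟩
  | div p q hp hq =>
    have h1 := (hmono (le_max_left p.deg q.deg)).trans hw
    have h2 := (hmono (le_max_right p.deg q.deg)).trans hw
    exact ⟨hp h.1 h1 ((h.1.abs_eval_lt hR).trans_le h1),
      hq h.2 h2 ((h.2.abs_eval_lt hR).trans_le h2), he⟩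

/-- Words of `w` bits hold the values of all expressions of degree at most `4` in numbers less
than `R`. -/
def Room (w : ℕ) (R : ℤ) : Prop := 8 ≤ R ∧ R ^ 4 ≤ 2 ^ w

theorem Room.fits {w : ℕ} {R : ℤ} (h : Room w R) {p : Exp} {σ : Mem} (hp : p.AtomsLt R σ)
    (hd : p.deg ≤ 4) : p.Fits w σ :=
  hp.fits (by linarith [h.1])
    ((pow_le_pow_right₀ (by linarith [h.1]) hd).trans h.2)

/-! ### Registers and loops over the edges -/

/-- The private arrays of the approximation scheme. Scalars live in cell `0` of their array. -/
inductive Reg : Type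
  | cnt | nodes | edges | src | snk | budget | tails | heads | caps | costs | fees
  | feeSum | costSum | scale | lo | hi | mid | fee | feeLo | feeHi | flowLo | flowHi | wLo | wHi

/-- The name of the array of a register. The arrays `0, …, E + 7` are left to the input, to the
output, and to the minimum cost flow program. -/
def Reg.addr (E : ℕ) : Reg → ℕ
  | cnt => E + 8 | nodes => E + 9 | edges => E + 10 | src => E + 11 | snk => E + 12
  | budget => E + 13 | tails => E + 14 | heads => E + 15 | caps => E + 16 | costs => E + 17
  | fees => E + 18 | feeSum => E + 19 | costSum => E + 20 | scale => E + 21 | lo => E + 22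
  | hi => E + 23 | mid => E + 24 | fee => E + 25 | feeLo => E + 26 | feeHi => E + 27
  | flowLo => E + 28 | flowHi => E + 29 | wLo => E + 30 | wHi => E + 31

theorem Reg.addr_ge (E : ℕ) (r : Reg) : E + 8 ≤ r.addr E := by
  cases r <;> simp [addr]

theorem Reg.addr_inj {E : ℕ} {r r' : Reg} : r.addr E = r'.addr E ↔ r = r' := by
  cases r <;> cases r' <;> simp [addr]

theorem Reg.addr_ne_of_lt {E a : ℕ} (r : Reg) (h : a < 8) : r.addr E ≠ a := by
  have := r.addr_ge E
  omega

theorem Reg.ne_addr_of_lt {E a : ℕ} (r : Reg) (h : a < 8) : a ≠ r.addr E :=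
  (r.addr_ne_of_lt h).symm

/-- The value of a scalar register. -/
def Reg.val (E : ℕ) (r : Reg) : Exp := .read (r.addr E) (.const 0)

/-- The cell of array `a` whose index is the loop counter. -/
def item (E a : ℕ) : Exp := .read a (Reg.cnt.val E)

/-- The assignment of an expression to the scalar in cell `0` of an array. -/
def set (a : ℕ) (p : Exp) : Prog := .assign a (.const 0) p

section Machine

variable {w : ℕ} {R : ℤ} {E m : ℕ}

theorem Room.pos (h : Room w R) : 0 < R := by linarith [h.1]

theorem runs_set (hw : Room w R) {a : ℕ} {p : Exp} {σ : Mem} (hp : p.AtomsLt R σ)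
    (hd : p.deg ≤ 4) : Runs w (set a p) σ (p.steps + 2) (write σ a 0 (p.eval σ)) := by
  have h := Runs.assign (a := a) (i := .const 0) (p := p) (σ := σ) (w := w)
    (hw.fits (p := .const 0) (by simpa [Exp.AtomsLt] using hw.pos) (by simp [Exp.deg]))
    (hw.fits hp hd)
  exact h.mono_time (by simp [Exp.steps]; omega)

/-- The loop which runs `P` once for each edge. The index of the edge is the value of the register
`cnt`. -/
def forEdges (E : ℕ) (P : Prog) : Prog :=
  .seq (set (Reg.cnt.addr E) (.const 0))
    (.loop (.sub (Reg.edges.val E) (Reg.cnt.val E))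
      (.seq P (set (Reg.cnt.addr E) (.add (Reg.cnt.val E) (.const 1)))))

/-- The loop, entered when `d` edges are left. -/
theorem runs_forEdges_aux (hw : Room w R) (hm : (m : ℤ) < R) {P : Prog} {t : ℕ}
    {J : ℕ → Mem → Prop} (hJ : ∀ i σ τ, (∀ a, a ≠ Reg.cnt.addr E → τ a = σ a) → J i σ → J i τ)
    (hJm : ∀ i σ, J i σ → σ (Reg.edges.addr E) 0 = m)
    (hP : ∀ i < m, ∀ σ, J i σ → σ (Reg.cnt.addr E) 0 = i →
      ∃ τ, Runs w P σ t τ ∧ τ (Reg.cnt.addr E) 0 = i ∧ J (i + 1) τ)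
    (d : ℕ) : ∀ i, i + d = m → ∀ σ, J i σ → σ (Reg.cnt.addr E) 0 = i →
    ∃ τ, Runs w (.loop (.sub (Reg.edges.val E) (Reg.cnt.val E))
      (.seq P (set (Reg.cnt.addr E) (.add (Reg.cnt.val E) (.const 1))))) σ
      (d * (t + 12) + 6) τ ∧ J m τ := by
  have hcond : ∀ i ≤ m, ∀ σ, J i σ → σ (Reg.cnt.addr E) 0 = i →
      (Exp.sub (Reg.edges.val E) (Reg.cnt.val E)).Fits w σ ∧
      (Exp.sub (Reg.edges.val E) (Reg.cnt.val E)).eval σ = m - i := by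
    intro i hi σ hσ hc
    have h0 := hw.pos
    constructor
    · refine hw.fits ?_ (by simp [Exp.deg, Reg.val])
      have : (i : ℤ) < R := by omega
      simp [Exp.AtomsLt, Reg.val, Exp.eval, hc, hJm i σ hσ, h0, hm, this]
    · simp [Reg.val, Exp.eval, hc, hJm i σ hσ]
  induction d with
  | zero =>
    intro i hi σ hσ hc
    obtain ⟨hf, he⟩ := hcond i (by omega) σ hσ hc
    obtain rfl : i = m := by omega
    exact ⟨σ, (Runs.loop_stop hf (by omega)).mono_time (by simp [Exp.steps, Reg.val]), hσ⟩
  | succ d ih =>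
    intro i hi σ hσ hc
    obtain ⟨hf, he⟩ := hcond i (by omega) σ hσ hc
    obtain ⟨τ, hτ, hτc, hτJ⟩ := hP i (by omega) σ hσ hc
    have h0 := hw.pos
    have h4 := hw.1
    have hs := runs_set hw (a := Reg.cnt.addr E) (p := .add (Reg.cnt.val E) (.const 1)) (σ := τ)
      (by
        have : (i : ℤ) < R := by omega
        have : 1 < R := by omega
        simp [Exp.AtomsLt, Reg.val, Exp.eval, *])
      (by simp [Exp.deg, Reg.val])
    obtain ⟨τ', hτ', hτJ'⟩ := ih (i + 1) (by omega)
      (write τ (Reg.cnt.addr E) 0 ((Exp.add (Reg.cnt.val E) (.const 1)).eval τ))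
      (hJ _ τ _ (fun a ha => write_of_ne _ _ _ ha) hτJ)
      (by simp [write_cell, Exp.eval, Reg.val, hτc])
    refine ⟨τ', (Runs.loop_step hf (by omega) (hτ.seq hs) hτ').mono_time ?_, hτJ'⟩
    simp [Exp.steps, Reg.val]
    ring_nf
    omega

/-- The invariant rule for loops over the edges. -/
theorem runs_forEdges (hw : Room w R) (hm : (m : ℤ) < R) {P : Prog} {t : ℕ}
    {J : ℕ → Mem → Prop} (hJ : ∀ i σ τ, (∀ a, a ≠ Reg.cnt.addr E → τ a = σ a) → J i σ → J i τ)
    (hJm : ∀ i σ, J i σ → σ (Reg.edges.addr E) 0 = m)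
    (hP : ∀ i < m, ∀ σ, J i σ → σ (Reg.cnt.addr E) 0 = i →
      ∃ τ, Runs w P σ t τ ∧ τ (Reg.cnt.addr E) 0 = i ∧ J (i + 1) τ)
    {σ : Mem} (h0 : J 0 σ) :
    ∃ τ, Runs w (forEdges E P) σ ((m + 1) * (t + 12)) τ ∧ J m τ := by
  have hs := runs_set hw (a := Reg.cnt.addr E) (p := .const 0) (σ := σ)
    (by simpa [Exp.AtomsLt] using hw.pos) (by simp [Exp.deg])
  obtain ⟨τ, hτ, hJτ⟩ := runs_forEdges_aux hw hm hJ hJm hP m 0 (by omega)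
    (write σ (Reg.cnt.addr E) 0 ((Exp.const 0).eval σ))
    (hJ _ σ _ (fun a ha => write_of_ne _ _ _ ha) h0) (by simp [write_cell, Exp.eval])
  refine ⟨τ, (hs.seq hτ).mono_time ?_, hJτ⟩
  simp [Exp.steps]
  ring_nf
  omega

/-- For each edge, the value of `p` is written into the array `dst`. -/
def mapEdges (E dst : ℕ) (p : Exp) : Prog := forEdges E (.assign dst (Reg.cnt.val E) p)

/-- The scalar `acc` becomes the sum of the values of `p` over all edges. -/
def sumEdges (E acc : ℕ) (p : Exp) : Prog :=
  .seq (set acc (.const 0)) (forEdges E (set acc (.add (.read acc (.const 0)) p)))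

/-- The invariant is that the first `i` cells have been written. The expression `p` must not depend
on `dst`, which changes during the loop. -/
theorem runs_mapEdges (hw : Room w R) (hm : (m : ℤ) < R) {dst : ℕ} {p : Exp} {f : ℤ → ℤ}
    {σ : Mem} (hσ : σ (Reg.edges.addr E) 0 = m) (hc : dst ≠ Reg.cnt.addr E)
    (he : dst ≠ Reg.edges.addr E) (hd : p.deg ≤ 4)
    (hp : ∀ i < m, ∀ τ : Mem, (∀ a, a ≠ dst → a ≠ Reg.cnt.addr E → τ a = σ a) →
      τ (Reg.cnt.addr E) 0 = i → p.eval τ = f i ∧ p.AtomsLt R τ) :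
    ∃ τ, Runs w (mapEdges E dst p) σ ((m + 1) * (p.steps + 15)) τ ∧
      (∀ a, a ≠ dst → a ≠ Reg.cnt.addr E → τ a = σ a) ∧
      ∀ j, τ dst j = if 0 ≤ j ∧ j < m then f j else σ dst j := by
  obtain ⟨τ, hτ, hJ⟩ := runs_forEdges (E := E) (P := .assign dst (Reg.cnt.val E) p) hw hm
    (t := p.steps + 3)
    (J := fun i τ => (∀ a, a ≠ dst → a ≠ Reg.cnt.addr E → τ a = σ a) ∧
      ∀ j, τ dst j = if 0 ≤ j ∧ j < i then f j else σ dst j)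
    (fun i τ τ' h hJ => ⟨fun a h1 h2 => (h a h2).trans (hJ.1 a h1 h2),
      fun j => by rw [h dst hc]; exact hJ.2 j⟩)
    (fun i τ hJ => by rw [hJ.1 _ he.symm (by simp [Reg.addr_inj]), hσ])
    (fun i hi τ hJ hτ => by
      obtain ⟨h1, h2⟩ := hp i hi τ hJ.1 hτ
      have h0 := hw.pos
      have hiR : (i : ℤ) < R := by omega
      refine ⟨_, (Runs.assign (hw.fits (p := Reg.cnt.val E) ?_ ?_)
        (hw.fits h2 hd)).mono_time ?_, ?_, ?_, ?_⟩
      · simp [Exp.AtomsLt, Reg.val, Exp.eval, hτ, h0, hiR]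
      · simp [Exp.deg, Reg.val]
      · simp [Exp.steps, Reg.val]; omega
      · rw [write_of_ne _ _ _ hc.symm, hτ]
      · intro a ha ha'
        rw [write_of_ne _ _ _ ha, hJ.1 a ha ha']
      · intro j
        have : (Reg.cnt.val E).eval τ = i := by simpa [Reg.val, Exp.eval] using hτ
        rw [write_same, this, h1]
        by_cases hj : j = i
        · subst hj
          simp
        · rw [Function.update_of_ne hj, hJ.2 j]
          congr 1
          simp only [eq_iff_iff]
          push_cast
          omega)
    (σ := σ) ⟨fun _ _ _ => rfl, fun j => by rw [if_neg]; push_cast; omega⟩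
  exact ⟨τ, hτ, hJ⟩

/-- The summands are nonnegative, so that the partial sums fit into words if the sum does. -/
theorem runs_sumEdges (hw : Room w R) (hm : (m : ℤ) < R) {acc : ℕ} {p : Exp} {f : ℕ → ℤ}
    {σ : Mem} (hσ : σ (Reg.edges.addr E) 0 = m) (hc : acc ≠ Reg.cnt.addr E)
    (he : acc ≠ Reg.edges.addr E) (hd : p.deg ≤ 3)
    (hf : ∀ i < m, 0 ≤ f i) (hfR : ∑ i ∈ range m, f i < R)
    (hp : ∀ i < m, ∀ τ : Mem, (∀ a, a ≠ acc → a ≠ Reg.cnt.addr E → τ a = σ a) →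
      τ (Reg.cnt.addr E) 0 = i → p.eval τ = f i ∧ p.AtomsLt R τ) :
    ∃ τ, Runs w (sumEdges E acc p) σ ((m + 1) * (p.steps + 20)) τ ∧
      (∀ a, a ≠ acc → a ≠ Reg.cnt.addr E → τ a = σ a) ∧
      τ acc 0 = ∑ i ∈ range m, f i := by
  have h0 := hw.pos
  have hs := runs_set hw (a := acc) (p := .const 0) (σ := σ)
    (by simpa [Exp.AtomsLt] using hw.pos) (by simp [Exp.deg])
  obtain ⟨τ, hτ, hJ⟩ := runs_forEdges (E := E)
    (P := set acc (.add (.read acc (.const 0)) p)) hw hm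
    (t := p.steps + 5)
    (J := fun i τ => (∀ a, a ≠ acc → a ≠ Reg.cnt.addr E → τ a = σ a) ∧
      τ acc 0 = ∑ i ∈ range i, f i)
    (fun i τ τ' h hJ => ⟨fun a h1 h2 => (h a h2).trans (hJ.1 a h1 h2),
      by rw [h acc hc]; exact hJ.2⟩)
    (fun i τ hJ => by rw [hJ.1 _ he.symm (by simp [Reg.addr_inj]), hσ])
    (fun i hi τ hJ hτ => by
      obtain ⟨h1, h2⟩ := hp i hi τ hJ.1 hτ
      have hnn : 0 ≤ ∑ i ∈ range i, f i :=
        sum_nonneg fun k hk => hf k (by rw [mem_range] at hk; omega)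
      have hlt : ∑ i ∈ range i, f i < R := by
        refine lt_of_le_of_lt (sum_le_sum_of_subset_of_nonneg ?_ ?_) hfR
        · exact range_subset_range.2 hi.le
        · exact fun k hk _ => hf k (mem_range.1 hk)
      refine ⟨_, (runs_set hw ?_ ?_).mono_time ?_, ?_, ?_, ?_⟩
      · simp [Exp.AtomsLt, Exp.eval, hJ.2, abs_of_nonneg hnn, h0, hlt, h2]
      · simp [Exp.deg]; omega
      · simp [Exp.steps]; omega
      · rw [write_of_ne _ _ _ hc.symm, hτ]
      · intro a ha ha'
        rw [write_of_ne _ _ _ ha, hJ.1 a ha ha']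
      · rw [write_cell, sum_range_succ, ← h1, ← hJ.2]
        simp [Exp.eval])
    (σ := write σ acc 0 ((Exp.const 0).eval σ))
    ⟨fun a ha _ => write_of_ne _ _ _ ha, by simp [write_cell, Exp.eval]⟩
  refine ⟨τ, (hs.seq hτ).mono_time ?_, hJ⟩
  simp [Exp.steps]
  ring_nf
  omega

/-- The program which erases the arrays `0, …, n`. -/
def resetUpTo : ℕ → Prog
  | 0 => .reset 0
  | n + 1 => .seq (resetUpTo n) (.reset (n + 1))

theorem runs_resetUpTo (n : ℕ) (σ : Mem) :
    Runs w (resetUpTo n) σ (n + 1) (fun a => if a ≤ n then 0 else σ a) := by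
  induction n with
  | zero =>
    refine ⟨1, le_rfl, ?_⟩
    have h : (fun a => if a ≤ 0 then 0 else σ a) = Function.update σ 0 0 := by
      funext a
      by_cases h : a = 0 <;> simp [h]
    rw [h]
    exact .reset 0 σ
  | succ n ih =>
    refine ih.seq ⟨1, le_rfl, ?_⟩
    have h : (fun a => if a ≤ n + 1 then 0 else σ a) =
        Function.update (fun a => if a ≤ n then 0 else σ a) (n + 1) 0 := by
      funext a
      by_cases h : a = n + 1
      · simp [h]
      · have : a ≤ n + 1 ↔ a ≤ n := by omega
        simp [h, this]
    rw [h]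
    exact .reset (n + 1) _

end Machine

/-! ### Arrays that hold lists -/

theorem arrayOf_ofFn {n : ℕ} (f : Fin n → ℤ) (j : ℤ) :
    arrayOf (List.ofFn f) j =
      if h : 0 ≤ j ∧ j < n then f ⟨j.toNat, by omega⟩ else 0 := by
  unfold arrayOf
  by_cases h0 : 0 ≤ j
  · by_cases h1 : j < n
    · rw [if_pos h0, dif_pos ⟨h0, h1⟩, List.getD_eq_getElem _ _ (by simp; omega)]
      simp
    · rw [if_pos h0, dif_neg (by tauto), List.getD_eq_default _ _ (by simp; omega)]
  · rw [if_neg h0, dif_neg (by tauto)]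

theorem arrayOf_ofFn_natCast {n : ℕ} (f : Fin n → ℤ) (e : Fin n) :
    arrayOf (List.ofFn f) ((e : ℕ) : ℤ) = f e := by
  rw [arrayOf_ofFn, dif_pos ⟨by omega, by have := e.2; omega⟩]
  simp

theorem arrayOf_four (a b c d : ℤ) :
    arrayOf [a, b, c, d] =
      Function.update (Function.update (Function.update
        (Function.update (0 : ℤ → ℤ) 0 a) 1 b) 2 c) 3 d := by
  ext j
  by_cases h : 0 ≤ j ∧ j < 4
  · obtain ⟨h0, h4⟩ := h
    interval_cases j <;> simp [arrayOf]
  · have h0 : j ≠ 0 := by omega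
    have h1 : j ≠ 1 := by omega
    have h2 : j ≠ 2 := by omega
    have h3 : j ≠ 3 := by omega
    simp only [Function.update_of_ne, h0, h1, h2, h3, ne_eq, not_false_eq_true, Pi.zero_apply,
      arrayOf]
    split_ifs with hj
    · rw [List.getD_eq_default]
      simp
      omega
    · rfl

/-! ### Lagrangian relaxation -/

namespace MCFInstance

variable (J : MCFInstance)

theorem isFlow_zero : J.IsFlow fun _ => 0 :=
  ⟨fun _ _ _ => by simp, fun _ => ⟨le_rfl, Nat.cast_nonneg _⟩⟩

variable {J}

theorem IsFlow.combo {x y : Fin J.m → ℝ} (hx : J.IsFlow x) (hy : J.IsFlow y) {a b : ℝ}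
    (ha : 0 ≤ a) (hb : 0 ≤ b) (hab : a + b = 1) : J.IsFlow fun e => a * x e + b * y e := by
  refine ⟨fun v hs ht => ?_, fun e => ⟨?_, ?_⟩⟩
  · have h1 := hx.1 v hs ht
    have h2 := hy.1 v hs ht
    simp only [sum_add_distrib, ← mul_sum]
    linear_combination a * h1 + b * h2
  · have h1 := (hx.2 e).1
    have h2 := (hy.2 e).1
    positivity
  · have h1 := mul_le_mul_of_nonneg_left (hx.2 e).2 ha
    have h2 := mul_le_mul_of_nonneg_left (hy.2 e).2 hb
    calc a * x e + b * y e ≤ a * J.cap e + b * J.cap e := add_le_add h1 h2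
      _ = J.cap e := by rw [← add_mul, hab, one_mul]

end MCFInstance

namespace BCInstance

variable (I : BCInstance)

/-- The Lagrangian relaxation of the budget constraint with multiplier `p / q`, multiplied by
`q`: the minimum cost flow problem with costs `q c_e + p b_e`. -/
abbrev lagrangian (q p : ℤ) : MCFInstance :=
  { I.toMCFInstance with cost := fun e => q * I.cost e + p * (I.fee e : ℤ) }

/-- The usage fee of an integral flow. -/
def intFee (x : Fin I.m → ℤ) : ℤ := ∑ e, (I.fee e : ℤ) * x e

/-- The cost of an integral flow. -/
def intCost (x : Fin I.m → ℤ) : ℤ := ∑ e, I.cost e * x e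

/-- An upper bound on the usage fee of any flow. -/
def feeBound : ℤ := ∑ e, (I.cap e : ℤ) * (I.fee e : ℤ)

/-- An upper bound on the absolute cost of any flow. Squares of the costs save the machine the
computation of absolute values. -/
def costBound : ℤ := ∑ e, (I.cap e : ℤ) * (I.cost e * I.cost e)

/-- The common denominator of the multipliers which the search tries. -/
def scale : ℤ := I.feeBound * I.feeBound + 1

/-- The search for the multiplier `p / scale` stays below this value of `p`. -/
def searchBound : ℤ := I.scale * (I.costBound + 1) + 2

/-- The integral vector `x` is a minimum cost flow for the multiplier `p / q`. -/
def IsLagrangianMin (q p : ℤ) (x : Fin I.m → ℤ) : Prop :=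
  (I.lagrangian q p).IsMinCostFlow fun e => (x e : ℝ)

variable {I}

theorem totalCost_lagrangian (q p : ℤ) (x : Fin I.m → ℝ) :
    (I.lagrangian q p).totalCost x = q * I.totalCost x + p * I.totalFee x := by
  unfold MCFInstance.totalCost totalFee
  rw [mul_sum, mul_sum, ← sum_add_distrib]
  refine sum_congr rfl fun e _ => ?_
  push_cast
  ring

theorem totalFee_intCast (x : Fin I.m → ℤ) : I.totalFee (fun e => (x e : ℝ)) = I.intFee x := by
  simp [totalFee, intFee]

theorem totalCost_intCast (x : Fin I.m → ℤ) : I.totalCost (fun e => (x e : ℝ)) = I.intCost x := by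
  simp [MCFInstance.totalCost, intCost]

theorem IsLagrangianMin.le {q p : ℤ} {x : Fin I.m → ℤ} (h : I.IsLagrangianMin q p x)
    {y : Fin I.m → ℝ} (hy : I.IsFlow y) :
    q * (I.intCost x : ℝ) + p * I.intFee x ≤ q * I.totalCost y + p * I.totalFee y := by
  have := h.2 y hy
  rwa [totalCost_lagrangian, totalCost_lagrangian, totalFee_intCast, totalCost_intCast] at this

theorem IsLagrangianMin.int_le {q p : ℤ} {x : Fin I.m → ℤ} (h : I.IsLagrangianMin q p x)
    {y : Fin I.m → ℤ} (hy : I.IsFlow fun e => (y e : ℝ)) :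
    q * I.intCost x + p * I.intFee x ≤ q * I.intCost y + p * I.intFee y := by
  have := h.le hy
  rw [totalFee_intCast, totalCost_intCast] at this
  exact_mod_cast this

theorem intFlow_nonneg {x : Fin I.m → ℤ} (hx : I.IsFlow fun e => (x e : ℝ)) (e : Fin I.m) :
    0 ≤ x e :=
  Int.cast_nonneg_iff.1 (hx.2 e).1

theorem intFlow_le_cap {x : Fin I.m → ℤ} (hx : I.IsFlow fun e => (x e : ℝ)) (e : Fin I.m) :
    x e ≤ I.cap e := by
  have h : (x e : ℝ) ≤ I.cap e := (hx.2 e).2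
  exact_mod_cast h

theorem intFlow_fee_nonneg {x : Fin I.m → ℤ} (hx : I.IsFlow fun e => (x e : ℝ)) :
    0 ≤ I.intFee x :=
  sum_nonneg fun e _ => mul_nonneg (by positivity) (intFlow_nonneg hx e)

theorem intFlow_fee_le {x : Fin I.m → ℤ} (hx : I.IsFlow fun e => (x e : ℝ)) :
    I.intFee x ≤ I.feeBound :=
  sum_le_sum fun e _ => by
    rw [mul_comm (I.cap e : ℤ)]
    exact mul_le_mul_of_nonneg_left (intFlow_le_cap hx e) (by positivity)

theorem intFlow_neg_costBound_le {x : Fin I.m → ℤ} (hx : I.IsFlow fun e => (x e : ℝ)) :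
    -I.costBound ≤ I.intCost x := by
  unfold costBound intCost
  rw [← sum_neg_distrib]
  refine sum_le_sum fun e _ => ?_
  have h0 := intFlow_nonneg hx e
  have h1 := intFlow_le_cap hx e
  have h2 : 0 ≤ I.cost e * I.cost e + I.cost e := by
    rcases le_or_gt 0 (I.cost e) with h | h <;> nlinarith
  nlinarith [mul_self_nonneg (I.cost e)]

theorem feeBound_nonneg : 0 ≤ I.feeBound := sum_nonneg fun e _ => by positivity

theorem costBound_nonneg : 0 ≤ I.costBound :=
  sum_nonneg fun e _ => mul_nonneg (by positivity) (mul_self_nonneg _)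

theorem scale_pos : 0 < I.scale := by
  unfold scale
  nlinarith [mul_self_nonneg I.feeBound]

theorem two_le_searchBound : 2 ≤ I.searchBound := by
  unfold searchBound
  have := I.scale_pos
  have := I.costBound_nonneg
  nlinarith

/-- If a minimizer for the multiplier `0` obeys the budget, then it is optimal. -/
theorem IsLagrangianMin.isOptimal {q : ℤ} (hq : 0 < q) {x : Fin I.m → ℤ}
    (h : I.IsLagrangianMin q 0 x) (hb : I.intFee x ≤ I.budget) :
    I.IsOptimal fun e => (x e : ℝ) := by
  refine ⟨⟨h.1, ?_⟩, fun y hy => ?_⟩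
  · rw [totalFee_intCast]
    exact_mod_cast hb
  · have h1 := h.le hy.1
    have hq' : (0 : ℝ) < q := by exact_mod_cast hq
    rw [totalCost_intCast]
    simp only [Int.cast_zero, zero_mul, add_zero] at h1
    exact le_of_mul_le_mul_left h1 hq'

/-- For a large multiplier, the minimizers have usage fee `0`: a positive fee would cost more than
what can be gained over the zero flow. -/
theorem IsLagrangianMin.intFee_eq_zero {q p : ℤ} (hq : 0 < q) (hp : q * I.costBound < p)
    {x : Fin I.m → ℤ} (h : I.IsLagrangianMin q p x) : I.intFee x = 0 := by
  have h0 : I.IsFlow fun e => ((0 : Fin I.m → ℤ) e : ℝ) := by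
    simpa using I.toMCFInstance.isFlow_zero
  have h1 := h.int_le h0
  have h2 := intFlow_neg_costBound_le h.1
  have h3 : 0 ≤ I.intFee x := intFlow_fee_nonneg h.1
  have h4 : I.intCost (0 : Fin I.m → ℤ) = 0 := by simp [intCost]
  have h5 : I.intFee (0 : Fin I.m → ℤ) = 0 := by simp [intFee]
  rw [h4, h5] at h1
  by_contra hne
  have h6 : 1 ≤ I.intFee x := by omega
  have h7 := mul_nonneg hq.le I.costBound_nonneg
  have h8 := mul_le_mul_of_nonneg_left h2 hq.le
  have h9 := mul_le_mul_of_nonneg_left h6 (h7.trans hp.le)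
  linarith

variable {q p : ℤ} {x y : Fin I.m → ℤ}

/-- Let `x` and `y` be minimizers for the consecutive multipliers `p / q` and `(p + 1) / q`. If
`q` is large enough, then `x` is also a minimizer for the multiplier at which `x` and `y` have the
same Lagrangian value: there, the Lagrangian values of integral flows are multiples of `1 / Δ` with
`Δ = b(x) - b(y)`, and they cannot drop by `1 / Δ` on an interval of length `1 / q`. -/
theorem lagrangian_le_of_consecutive
    (hint : ∀ r s : ℤ, ∃ z, I.IsLagrangianMin r s z)
    (hx : I.IsLagrangianMin q p x) (hy : I.IsLagrangianMin q (p + 1) y)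
    (hq : I.feeBound * I.feeBound < q) (hxy : I.intFee y < I.intFee x)
    {z : Fin I.m → ℝ} (hz : I.IsFlow z) :
    ((I.intFee x - I.intFee y : ℤ) : ℝ) * I.intCost x +
        ((I.intCost y - I.intCost x : ℤ) : ℝ) * I.intFee x ≤
      ((I.intFee x - I.intFee y : ℤ) : ℝ) * I.totalCost z +
        ((I.intCost y - I.intCost x : ℤ) : ℝ) * I.totalFee z := by
  obtain ⟨v, hv⟩ := hint (I.intFee x - I.intFee y) (I.intCost y - I.intCost x)
  refine le_trans ?_ (hv.le hz)
  have h1 := hx.int_le hy.1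
  have h2 := hy.int_le hx.1
  have h3 := hx.int_le hv.1
  have hx0 := intFlow_fee_nonneg hx.1
  have hx1 := intFlow_fee_le hx.1
  have hy0 := intFlow_fee_nonneg hy.1
  have hv0 := intFlow_fee_nonneg hv.1
  have hv1 := intFlow_fee_le hv.1
  norm_cast
  by_contra! hlt
  set bx := I.intFee x
  set bY := I.intFee y
  set bv := I.intFee v
  set cx := I.intCost x
  set cy := I.intCost y
  set cv := I.intCost v
  set D := I.feeBound
  -- At the multiplier `Λ / Δ`, the flow `v` undercuts `x` by at least `1 / Δ`; at `p / q`, it does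
  -- not undercut `x`. The difference of the multipliers, `(q Λ - p Δ) / (q Δ)`, lies between `0` and
  -- `1 / q`, so `q ≤ (q Λ - p Δ) (b(x) - b(v)) ≤ D²`.
  set Δ := bx - bY with hΔ
  set Λ := cy - cx with hΛ
  have hD : 0 ≤ D := le_trans hx0 hx1
  have hq0 : 0 < q := lt_of_le_of_lt (mul_self_nonneg D) hq
  have ha : 0 ≤ q * Λ - p * Δ := by rw [hΔ, hΛ]; linarith
  have hb : q * Λ - p * Δ ≤ Δ := by rw [hΔ, hΛ]; linarith
  have hΔD : Δ ≤ D := by omega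
  have hΔ0 : 0 < Δ := by omega
  have e1 : Δ * (cv - cx) + Λ * (bv - bx) ≤ -1 := by nlinarith
  have e2 : 0 ≤ q * (cv - cx) + p * (bv - bx) := by nlinarith
  have e3 := mul_le_mul_of_nonneg_left e1 hq0.le
  have e4 := mul_nonneg hΔ0.le e2
  have e5 : (q * Λ - p * Δ) * (bv - bx) ≤ -q := by nlinarith
  have e6 : (q * Λ - p * Δ) * D ≤ D * D := mul_le_mul_of_nonneg_right (hb.trans hΔD) hD
  have e7 : (q * Λ - p * Δ) * (-D) ≤ (q * Λ - p * Δ) * (bv - bx) :=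
    mul_le_mul_of_nonneg_left (by omega) ha
  linarith

/-- The convex combination that exhausts the budget of two minimizers for consecutive multipliers,
on either side of the budget, is optimal. -/
theorem isOptimal_combo
    (hint : ∀ r s : ℤ, ∃ z, I.IsLagrangianMin r s z)
    (hp : 0 ≤ p) (hx : I.IsLagrangianMin q p x) (hy : I.IsLagrangianMin q (p + 1) y)
    (hq : I.feeBound * I.feeBound < q) (hbx : I.budget < I.intFee x)
    (hby : I.intFee y ≤ I.budget) :
    I.IsOptimal fun e => (((I.budget - I.intFee y) * x e + (I.intFee x - I.budget) * y e : ℤ) : ℝ) /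
      ((I.intFee x - I.intFee y : ℤ) : ℝ) := by
  have hq0 : 0 < q := lt_of_le_of_lt (mul_self_nonneg _) hq
  have hxy : I.intFee y < I.intFee x := by omega
  have key := fun {z : Fin I.m → ℝ} (hz : I.IsFlow z) =>
    lagrangian_le_of_consecutive hint hx hy hq hxy hz
  have hΛ : 0 ≤ I.intCost y - I.intCost x := by
    have h1 := hx.int_le hy.1
    by_contra! h
    have : q * (I.intCost y - I.intCost x) < 0 := mul_neg_of_pos_of_neg hq0 h
    have : 0 ≤ p * (I.intFee x - I.intFee y) := mul_nonneg hp (by omega)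
    nlinarith
  have hΔ : (0 : ℝ) < ((I.intFee x - I.intFee y : ℤ) : ℝ) := by exact_mod_cast (by omega)
  have hΛ' : (0 : ℝ) ≤ ((I.intCost y - I.intCost x : ℤ) : ℝ) := by exact_mod_cast hΛ
  have ha : (0 : ℝ) ≤ ((I.budget - I.intFee y : ℤ) : ℝ) := by exact_mod_cast (by omega)
  have hb : (0 : ℝ) ≤ ((I.intFee x - I.budget : ℤ) : ℝ) := by exact_mod_cast (by omega)
  push_cast at hΔ hΛ' ha hb key
  have hform : (fun e => (((I.budget - I.intFee y) * x e + (I.intFee x - I.budget) * y e : ℤ) : ℝ) /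
      ((I.intFee x - I.intFee y : ℤ) : ℝ)) = fun e =>
      (((I.budget : ℝ) - I.intFee y) / (I.intFee x - I.intFee y)) * (x e : ℝ) +
      ((I.intFee x - I.budget) / (I.intFee x - I.intFee y)) * (y e : ℝ) := by
    ext e
    push_cast
    field_simp
  rw [hform]
  have hfee : I.totalFee (fun e =>
      (((I.budget : ℝ) - I.intFee y) / (I.intFee x - I.intFee y)) * (x e : ℝ) +
      ((I.intFee x - I.budget) / (I.intFee x - I.intFee y)) * (y e : ℝ)) = I.budget := by
    have : ∀ a b : ℝ, I.totalFee (fun e => a * (x e : ℝ) + b * (y e : ℝ)) =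
        a * I.intFee x + b * I.intFee y := by
      intro a b
      rw [← totalFee_intCast, ← totalFee_intCast, totalFee, totalFee, totalFee, mul_sum, mul_sum,
        ← sum_add_distrib]
      exact sum_congr rfl fun e _ => by ring
    rw [this]
    field_simp
    ring
  refine ⟨⟨hx.1.combo hy.1 (by positivity) (by positivity) (by field_simp; ring), hfee.le⟩, ?_⟩
  intro z hz
  have hcost : ∀ a b : ℝ, I.totalCost (fun e => a * (x e : ℝ) + b * (y e : ℝ)) =
      a * I.intCost x + b * I.intCost y := by
    intro a b
    rw [← totalCost_intCast, ← totalCost_intCast, MCFInstance.totalCost, MCFInstance.totalCost,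
      MCFInstance.totalCost, mul_sum, mul_sum, ← sum_add_distrib]
    exact sum_congr rfl fun e _ => by ring
  rw [hcost]
  have h1 := key hz.1
  have h2 : ((I.intCost y : ℝ) - I.intCost x) * I.totalFee z ≤
      (I.intCost y - I.intCost x) * I.budget := mul_le_mul_of_nonneg_left hz.2 hΛ'
  refine le_of_mul_le_mul_left (le_trans (le_of_eq ?_) (show
    ((I.intFee x : ℝ) - I.intFee y) * I.intCost x + (I.intCost y - I.intCost x) * I.intFee x
      - (I.intCost y - I.intCost x) * I.budget ≤ _ by linarith)) hΔ
  field_simp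
  ring

end BCInstance

section Scheme

variable {w : ℕ} {R : ℤ} {E m : ℕ}

theorem runs_set_eq (hw : Room w R) {a : ℕ} {p : Exp} {σ : Mem} {v : ℤ} (he : p.eval σ = v)
    (hp : p.AtomsLt R σ) (hd : p.deg ≤ 4) :
    ∃ τ, Runs w (set a p) σ (p.steps + 2) τ ∧ (∀ b, b ≠ a → τ b = σ b) ∧ τ a 0 = v :=
  ⟨_, runs_set hw hp hd, fun _ hb => write_of_ne _ _ _ hb, by rw [write_cell, he]⟩

/-- If `dst` has been erased before, then the array agrees with the input format of a list also
outside the range of the loop. -/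
theorem runs_mapEdges_ofFn (hw : Room w R) (hm : (m : ℤ) < R) {dst : ℕ} {p : Exp}
    {f : Fin m → ℤ} {σ : Mem} (hσ : σ (Reg.edges.addr E) 0 = m) (hc : dst ≠ Reg.cnt.addr E)
    (he : dst ≠ Reg.edges.addr E) (hd : p.deg ≤ 4)
    (hp : ∀ e : Fin m, ∀ τ : Mem, (∀ a, a ≠ dst → a ≠ Reg.cnt.addr E → τ a = σ a) →
      τ (Reg.cnt.addr E) 0 = ((e : ℕ) : ℤ) → p.eval τ = f e ∧ p.AtomsLt R τ) :
    ∃ τ, Runs w (mapEdges E dst p) σ ((m + 1) * (p.steps + 15)) τ ∧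
      (∀ a, a ≠ dst → a ≠ Reg.cnt.addr E → τ a = σ a) ∧
      (∀ e : Fin m, τ dst ((e : ℕ) : ℤ) = f e) ∧
      (σ dst = 0 → τ dst = arrayOf (List.ofFn f)) := by
  obtain ⟨τ, h1, h2, h3⟩ := runs_mapEdges (f := arrayOf (List.ofFn f)) hw hm hσ hc he hd
    (fun i hi τ hτ hτc => by
      have := hp ⟨i, hi⟩ τ hτ hτc
      rwa [← arrayOf_ofFn_natCast f ⟨i, hi⟩] at this)
  refine ⟨τ, h1, h2, fun e => ?_, fun h0 => ?_⟩
  · rw [h3, if_pos ⟨by omega, by have := e.2; omega⟩, arrayOf_ofFn_natCast]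
  · funext j
    rw [h3, h0, arrayOf_ofFn]
    by_cases h : 0 ≤ j ∧ j < m
    · simp [h]
    · rw [if_neg h, dif_neg h, Pi.zero_apply]

theorem runs_sumEdges_fin (hw : Room w R) (hm : (m : ℤ) < R) {acc : ℕ} {p : Exp}
    {f : Fin m → ℤ} {σ : Mem} (hσ : σ (Reg.edges.addr E) 0 = m) (hc : acc ≠ Reg.cnt.addr E)
    (he : acc ≠ Reg.edges.addr E) (hd : p.deg ≤ 3) (hf : ∀ e, 0 ≤ f e) (hfR : ∑ e, f e < R)
    (hp : ∀ e : Fin m, ∀ τ : Mem, (∀ a, a ≠ acc → a ≠ Reg.cnt.addr E → τ a = σ a) →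
      τ (Reg.cnt.addr E) 0 = ((e : ℕ) : ℤ) → p.eval τ = f e ∧ p.AtomsLt R τ) :
    ∃ τ, Runs w (sumEdges E acc p) σ ((m + 1) * (p.steps + 20)) τ ∧
      (∀ a, a ≠ acc → a ≠ Reg.cnt.addr E → τ a = σ a) ∧ τ acc 0 = ∑ e, f e := by
  have hsum : ∑ i ∈ range m, arrayOf (List.ofFn f) i = ∑ e, f e := by
    rw [← Fin.sum_univ_eq_sum_range (fun i : ℕ => arrayOf (List.ofFn f) (i : ℤ))]
    exact sum_congr rfl fun e _ => arrayOf_ofFn_natCast f e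
  rw [← hsum] at hfR ⊢
  refine runs_sumEdges (f := fun i : ℕ => arrayOf (List.ofFn f) i) hw hm hσ hc he hd
    (fun i hi => ?_) hfR (fun i hi τ hτ hτc => ?_)
  · have := hf ⟨i, hi⟩
    rwa [← arrayOf_ofFn_natCast f ⟨i, hi⟩] at this
  · have := hp ⟨i, hi⟩ τ hτ hτc
    rwa [← arrayOf_ofFn_natCast f ⟨i, hi⟩] at this

/-! ### The numbers of an instance -/

/-- The numbers which the approximation scheme stores are less than `R`. -/
structure BCInstance.Small (I : BCInstance) (R : ℤ) : Prop where
  nodes : (I.n : ℤ) < R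
  edges : (I.m : ℤ) < R
  cap : ∀ e, (I.cap e : ℤ) < R
  cost : ∀ e, |I.cost e| < R
  fee : ∀ e, (I.fee e : ℤ) < R
  budget : (I.budget : ℤ) < R
  feeBound : I.feeBound < R
  costBound : I.costBound < R
  scale : I.scale < R
  searchBound : I.searchBound < R

namespace BCInstance.Small

theorem pos {I : BCInstance} (h : I.Small R) : 0 < R := by
  have := h.nodes
  omega

theorem src {I : BCInstance} (h : I.Small R) : ((I.source : ℕ) : ℤ) < R := by
  have := h.nodes
  have := I.source.2
  omega

theorem snk {I : BCInstance} (h : I.Small R) : ((I.sink : ℕ) : ℤ) < R := by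
  have := h.nodes
  have := I.sink.2
  omega

theorem tail {I : BCInstance} (h : I.Small R) (e : Fin I.m) : ((I.tail e : ℕ) : ℤ) < R := by
  have := h.nodes
  have := (I.tail e).2
  omega

theorem head {I : BCInstance} (h : I.Small R) (e : Fin I.m) : ((I.head e : ℕ) : ℤ) < R := by
  have := h.nodes
  have := (I.head e).2
  omega

end BCInstance.Small

/-- The registers that keep a copy of the instance hold it, and `scale` has been computed. -/
structure Saved (I : BCInstance) (E : ℕ) (σ : Mem) : Prop where
  nodes : σ (Reg.nodes.addr E) 0 = I.n
  edges : σ (Reg.edges.addr E) 0 = I.m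
  src : σ (Reg.src.addr E) 0 = (I.source : ℕ)
  snk : σ (Reg.snk.addr E) 0 = (I.sink : ℕ)
  budget : σ (Reg.budget.addr E) 0 = I.budget
  tails : σ (Reg.tails.addr E) = arrayOf (List.ofFn fun e => ((I.tail e : ℕ) : ℤ))
  heads : σ (Reg.heads.addr E) = arrayOf (List.ofFn fun e => ((I.head e : ℕ) : ℤ))
  caps : σ (Reg.caps.addr E) = arrayOf (List.ofFn fun e => (I.cap e : ℤ))
  costs : σ (Reg.costs.addr E) = arrayOf (List.ofFn fun e => I.cost e)
  fees : σ (Reg.fees.addr E) = arrayOf (List.ofFn fun e => (I.fee e : ℤ))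
  scale : σ (Reg.scale.addr E) 0 = I.scale

/-- The registers that hold the instance and the scale. -/
def Reg.Permanent : Reg → Prop
  | nodes | edges | src | snk | budget | tails | heads | caps | costs | fees | scale => True
  | _ => False

theorem Saved.congr {I : BCInstance} {σ τ : Mem} (h : Saved I E σ)
    (hτ : ∀ r : Reg, r.Permanent → τ (r.addr E) = σ (r.addr E)) : Saved I E τ where
  nodes := by rw [hτ .nodes trivial, h.nodes]
  edges := by rw [hτ .edges trivial, h.edges]
  src := by rw [hτ .src trivial, h.src]
  snk := by rw [hτ .snk trivial, h.snk]
  budget := by rw [hτ .budget trivial, h.budget]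
  tails := by rw [hτ .tails trivial, h.tails]
  heads := by rw [hτ .heads trivial, h.heads]
  caps := by rw [hτ .caps trivial, h.caps]
  costs := by rw [hτ .costs trivial, h.costs]
  fees := by rw [hτ .fees trivial, h.fees]
  scale := by rw [hτ .scale trivial, h.scale]

/-- The copy of one of the input arrays into a register. -/
theorem runs_copy (hw : Room w R) (hm : (m : ℤ) < R) {src dst : ℕ} {f : Fin m → ℤ} {σ : Mem}
    (hσ : σ (Reg.edges.addr E) 0 = m) (hc : dst ≠ Reg.cnt.addr E)
    (he : dst ≠ Reg.edges.addr E) (hsd : src ≠ dst) (hsc : src ≠ Reg.cnt.addr E)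
    (hsrc : ∀ e : Fin m, σ src ((e : ℕ) : ℤ) = f e) (hf : ∀ e, |f e| < R) :
    ∃ τ, Runs w (mapEdges E dst (item E src)) σ ((m + 1) * 18) τ ∧
      (∀ a, a ≠ dst → a ≠ Reg.cnt.addr E → τ a = σ a) ∧
      (∀ e : Fin m, τ dst ((e : ℕ) : ℤ) = f e) ∧
      (σ dst = 0 → τ dst = arrayOf (List.ofFn f)) := by
  refine runs_mapEdges_ofFn hw hm hσ hc he (by simp [item, Reg.val, Exp.deg])
    fun e τ hτ hτc => ?_
  have h0 := hw.pos
  have heR : ((e : ℕ) : ℤ) < R := by have := e.2; omega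
  simp [item, Reg.val, Exp.eval, Exp.AtomsLt, hτc, hτ src hsd hsc, hsrc, hf, h0, heR]

/-! ### The program: reading the input -/

/-- The program which copies the input to private registers and sets up the search. -/
def saveInput (E : ℕ) : Prog :=
  .seq (set (Reg.nodes.addr E) (.read 0 (.const 0))) <|
  .seq (set (Reg.edges.addr E) (.read 0 (.const 1))) <|
  .seq (set (Reg.src.addr E) (.read 0 (.const 2))) <|
  .seq (set (Reg.snk.addr E) (.read 0 (.const 3))) <|
  .seq (set (Reg.budget.addr E) (.read 0 (.const 4))) <|
  .seq (mapEdges E (Reg.tails.addr E) (item E 1)) <|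
  .seq (mapEdges E (Reg.heads.addr E) (item E 2)) <|
  .seq (mapEdges E (Reg.caps.addr E) (item E 3)) <|
  .seq (mapEdges E (Reg.costs.addr E) (item E 4)) <|
  .seq (mapEdges E (Reg.fees.addr E) (item E 5)) <|
  .seq (sumEdges E (Reg.feeSum.addr E)
    (.mul (item E (Reg.caps.addr E)) (item E (Reg.fees.addr E)))) <|
  .seq (sumEdges E (Reg.costSum.addr E) (.mul (item E (Reg.caps.addr E))
    (.mul (item E (Reg.costs.addr E)) (item E (Reg.costs.addr E))))) <|
  .seq (set (Reg.scale.addr E)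
    (.add (.mul (Reg.feeSum.val E) (Reg.feeSum.val E)) (.const 1))) <|
  .seq (set (Reg.lo.addr E) (.const (-1)))
    (set (Reg.hi.addr E)
      (.add (.mul (Reg.scale.val E) (.add (Reg.costSum.val E) (.const 1))) (.const 2)))

/-- The sets and copies are traced one after the other. The registers for the fees and the flows of
the search are still zero at the end, as the search needs them. -/
theorem runs_saveInput (hw : Room w R) {I : BCInstance} (hI : I.Small R) (ε : ℚ) :
    ∃ τ, Runs w (saveInput E) (I.input ε) ((I.m + 1) * 250) τ ∧ Saved I E τ ∧
      τ (Reg.lo.addr E) 0 = -1 ∧ τ (Reg.hi.addr E) 0 = I.searchBound ∧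
      τ (Reg.feeLo.addr E) = 0 ∧ τ (Reg.feeHi.addr E) = 0 ∧
      τ (Reg.flowLo.addr E) = 0 ∧ τ (Reg.flowHi.addr E) = 0 := by
  have h0 := hw.pos
  have h8 := hw.1
  have hm := hI.edges
  have hreg : ∀ r : Reg, I.input ε (r.addr E) = 0 := by
    intro r
    have := r.addr_ge E
    obtain ⟨k, hk⟩ : ∃ k, r.addr E = k + 6 := ⟨r.addr E - 6, by omega⟩
    rw [hk]
    rfl
  have hin : ∀ i : ℕ, i < 5 → I.input ε 0 i = [(I.n : ℤ), (I.m : ℤ), ((I.source : ℕ) : ℤ),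
      ((I.sink : ℕ) : ℤ), (I.budget : ℤ)].getD i 0 := by
    intro i hi
    interval_cases i <;> rfl
  have e0 : I.input ε 0 0 = I.n := hin 0 (by norm_num)
  have e1 : I.input ε 0 1 = I.m := hin 1 (by norm_num)
  have e2 : I.input ε 0 2 = (I.source : ℕ) := hin 2 (by norm_num)
  have e3 : I.input ε 0 3 = (I.sink : ℕ) := hin 3 (by norm_num)
  have e4 : I.input ε 0 4 = I.budget := hin 4 (by norm_num)
  have l1 : (1 : ℤ) < R := by omega
  have l2 : (2 : ℤ) < R := by omega
  have l3 : (3 : ℤ) < R := by omega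
  have l4 : (4 : ℤ) < R := by omega
  have nn : ∀ {a b : Reg}, a ≠ b → a.addr E ≠ b.addr E := fun h => by
    rwa [ne_eq, Reg.addr_inj]
  obtain ⟨σ₁, r₁, f₁, v₁⟩ := runs_set_eq hw (a := Reg.nodes.addr E)
    (p := .read 0 (.const 0)) (σ := I.input ε) (v := I.n) (by simp [Exp.eval, e0])
    (by simp [Exp.eval, Exp.AtomsLt, e0, h0, hI.nodes]) (by simp [Exp.deg])
  obtain ⟨σ₂, r₂, f₂, v₂⟩ := runs_set_eq hw (a := Reg.edges.addr E)
    (p := .read 0 (.const 1)) (σ := σ₁) (v := I.m)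
    (by simp [Exp.eval, f₁, Reg.ne_addr_of_lt, e1])
    (by simp [Exp.eval, Exp.AtomsLt, f₁, Reg.ne_addr_of_lt, e1, l1, hm]) (by simp [Exp.deg])
  obtain ⟨σ₃, r₃, f₃, v₃⟩ := runs_set_eq hw (a := Reg.src.addr E)
    (p := .read 0 (.const 2)) (σ := σ₂) (v := (I.source : ℕ))
    (by simp [Exp.eval, f₁, f₂, Reg.ne_addr_of_lt, e2])
    (by simp [Exp.eval, Exp.AtomsLt, f₁, f₂, Reg.ne_addr_of_lt, e2, l2, hI.src])
    (by simp [Exp.deg])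
  obtain ⟨σ₄, r₄, f₄, v₄⟩ := runs_set_eq hw (a := Reg.snk.addr E)
    (p := .read 0 (.const 3)) (σ := σ₃) (v := (I.sink : ℕ))
    (by simp [Exp.eval, f₁, f₂, f₃, Reg.ne_addr_of_lt, e3])
    (by simp [Exp.eval, Exp.AtomsLt, f₁, f₂, f₃, Reg.ne_addr_of_lt, e3, l3, hI.snk])
    (by simp [Exp.deg])
  obtain ⟨σ₅, r₅, f₅, v₅⟩ := runs_set_eq hw (a := Reg.budget.addr E)
    (p := .read 0 (.const 4)) (σ := σ₄) (v := I.budget)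
    (by simp [Exp.eval, f₁, f₂, f₃, f₄, Reg.ne_addr_of_lt, e4])
    (by simp [Exp.eval, Exp.AtomsLt, f₁, f₂, f₃, f₄, Reg.ne_addr_of_lt, e4, l4, hI.budget])
    (by simp [Exp.deg])
  have g₅ : σ₅ (Reg.edges.addr E) 0 = I.m := by simp [f₃, f₄, f₅, v₂, Reg.addr_inj]
  have i₅ : ∀ a, a ≠ 0 → a < 8 → σ₅ a = I.input ε a := fun a ha ha' => by
    simp [f₁, f₂, f₃, f₄, f₅, Reg.ne_addr_of_lt _ ha']
  have y₅ : σ₅ (Reg.tails.addr E) = 0 ∧ σ₅ (Reg.heads.addr E) = 0 ∧ σ₅ (Reg.caps.addr E) = 0 ∧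
      σ₅ (Reg.costs.addr E) = 0 ∧ σ₅ (Reg.fees.addr E) = 0 ∧ σ₅ (Reg.feeLo.addr E) = 0 ∧
      σ₅ (Reg.feeHi.addr E) = 0 ∧ σ₅ (Reg.flowLo.addr E) = 0 ∧ σ₅ (Reg.flowHi.addr E) = 0 := by
    simp [f₁, f₂, f₃, f₄, f₅, Reg.addr_inj, hreg]
  obtain ⟨σ₆, r₆, f₆, -, v₆⟩ := runs_copy (src := 1) (dst := Reg.tails.addr E)
    (f := fun e => ((I.tail e : ℕ) : ℤ)) hw hm g₅ (nn (by simp)) (nn (by simp))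
    (Reg.ne_addr_of_lt _ (by simp)) (Reg.ne_addr_of_lt _ (by simp))
    (fun e => by rw [i₅ 1 (by simp) (by simp)]; exact arrayOf_ofFn_natCast _ _)
    (fun e => by simpa using hI.tail e)
  have g₆ : σ₆ (Reg.edges.addr E) 0 = I.m := by simp [f₆, g₅, Reg.addr_inj]
  obtain ⟨σ₇, r₇, f₇, -, v₇⟩ := runs_copy (src := 2) (dst := Reg.heads.addr E)
    (f := fun e => ((I.head e : ℕ) : ℤ)) hw hm g₆ (nn (by simp)) (nn (by simp))
    (Reg.ne_addr_of_lt _ (by simp)) (Reg.ne_addr_of_lt _ (by simp))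
    (fun e => by
      simp only [f₆, ne_eq, Reg.ne_addr_of_lt, Nat.reduceLT, not_false_eq_true,
        i₅ 2 (by simp) (by simp)]
      exact arrayOf_ofFn_natCast _ _)
    (fun e => by simpa using hI.head e)
  have g₇ : σ₇ (Reg.edges.addr E) 0 = I.m := by simp [f₇, g₆, Reg.addr_inj]
  obtain ⟨σ₈, r₈, f₈, -, v₈⟩ := runs_copy (src := 3) (dst := Reg.caps.addr E)
    (f := fun e => (I.cap e : ℤ)) hw hm g₇ (nn (by simp)) (nn (by simp))
    (Reg.ne_addr_of_lt _ (by simp)) (Reg.ne_addr_of_lt _ (by simp))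
    (fun e => by
      simp only [f₆, f₇, ne_eq, Reg.ne_addr_of_lt, Nat.reduceLT, not_false_eq_true,
        i₅ 3 (by simp) (by simp)]
      exact arrayOf_ofFn_natCast _ _)
    (fun e => by simpa using hI.cap e)
  have g₈ : σ₈ (Reg.edges.addr E) 0 = I.m := by simp [f₈, g₇, Reg.addr_inj]
  obtain ⟨σ₉, r₉, f₉, -, v₉⟩ := runs_copy (src := 4) (dst := Reg.costs.addr E)
    (f := fun e => I.cost e) hw hm g₈ (nn (by simp)) (nn (by simp))
    (Reg.ne_addr_of_lt _ (by simp)) (Reg.ne_addr_of_lt _ (by simp))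
    (fun e => by
      simp only [f₆, f₇, f₈, ne_eq, Reg.ne_addr_of_lt, Nat.reduceLT, not_false_eq_true,
        i₅ 4 (by simp) (by simp)]
      exact arrayOf_ofFn_natCast _ _)
    (fun e => by simpa using hI.cost e)
  have g₉ : σ₉ (Reg.edges.addr E) 0 = I.m := by simp [f₉, g₈, Reg.addr_inj]
  obtain ⟨σa, ra, fa, -, va⟩ := runs_copy (src := 5) (dst := Reg.fees.addr E)
    (f := fun e => (I.fee e : ℤ)) hw hm g₉ (nn (by simp)) (nn (by simp))
    (Reg.ne_addr_of_lt _ (by simp)) (Reg.ne_addr_of_lt _ (by simp))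
    (fun e => by
      simp only [f₆, f₇, f₈, f₉, ne_eq, Reg.ne_addr_of_lt, Nat.reduceLT, not_false_eq_true,
        i₅ 5 (by simp) (by simp)]
      exact arrayOf_ofFn_natCast _ _)
    (fun e => by simpa using hI.fee e)
  have ga : σa (Reg.edges.addr E) 0 = I.m := by simp [fa, g₉, Reg.addr_inj]
  have caps : σa (Reg.caps.addr E) = arrayOf (List.ofFn fun e => (I.cap e : ℤ)) := by
    rw [← v₈]
    · simp [fa, f₉, Reg.addr_inj]
    · simp [f₇, f₆, Reg.addr_inj, y₅]
  have costs : σa (Reg.costs.addr E) = arrayOf (List.ofFn fun e => I.cost e) := by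
    rw [← v₉]
    · simp [fa, Reg.addr_inj]
    · simp [f₈, f₇, f₆, Reg.addr_inj, y₅]
  have fees : σa (Reg.fees.addr E) = arrayOf (List.ofFn fun e => (I.fee e : ℤ)) := by
    rw [← va]
    simp [f₉, f₈, f₇, f₆, Reg.addr_inj, y₅]
  have eR : ∀ e : Fin I.m, ((e : ℕ) : ℤ) < R := fun e => by have := e.2; omega
  obtain ⟨σb, rb, fb, vb⟩ := runs_sumEdges_fin (acc := Reg.feeSum.addr E)
    (p := .mul (item E (Reg.caps.addr E)) (item E (Reg.fees.addr E)))
    (f := fun e => (I.cap e : ℤ) * (I.fee e : ℤ)) hw hm ga (nn (by simp)) (nn (by simp))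
    (by simp [Exp.deg, item, Reg.val]) (fun e => by positivity) hI.feeBound
    (fun e τ hτ hτc => by
      simp [item, Reg.val, Exp.eval, Exp.AtomsLt, hτc, hτ, Reg.addr_inj, caps, fees,
        arrayOf_ofFn_natCast, h0, eR, hI.cap, hI.fee])
  have gb : σb (Reg.edges.addr E) 0 = I.m := by simp [fb, ga, Reg.addr_inj]
  obtain ⟨σc, rc, fc, vc⟩ := runs_sumEdges_fin (acc := Reg.costSum.addr E)
    (p := .mul (item E (Reg.caps.addr E))
      (.mul (item E (Reg.costs.addr E)) (item E (Reg.costs.addr E))))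
    (f := fun e => (I.cap e : ℤ) * (I.cost e * I.cost e)) hw hm gb (nn (by simp)) (nn (by simp))
    (by simp [Exp.deg, item, Reg.val])
    (fun e => mul_nonneg (by positivity) (mul_self_nonneg _)) hI.costBound
    (fun e τ hτ hτc => by
      simp [item, Reg.val, Exp.eval, Exp.AtomsLt, hτc, hτ, fb, Reg.addr_inj, caps, costs,
        arrayOf_ofFn_natCast, h0, eR, hI.cap, hI.cost])
  have vb' : σb (Reg.feeSum.addr E) 0 = I.feeBound := vb
  have vc' : σc (Reg.costSum.addr E) 0 = I.costBound := vc
  have dR := hI.feeBound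
  have cR := hI.costBound
  have qR := hI.scale
  rw [← abs_of_nonneg I.feeBound_nonneg] at dR
  rw [← abs_of_nonneg I.costBound_nonneg] at cR
  rw [← abs_of_pos I.scale_pos] at qR
  obtain ⟨σd, rd, fd, vd⟩ := runs_set_eq hw (a := Reg.scale.addr E)
    (p := .add (.mul (Reg.feeSum.val E) (Reg.feeSum.val E)) (.const 1)) (σ := σc) (v := I.scale)
    (by simp [Exp.eval, Reg.val, fc, vb', Reg.addr_inj, BCInstance.scale])
    (by simp [Exp.eval, Exp.AtomsLt, Reg.val, fc, vb', Reg.addr_inj, h0, l1, dR])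
    (by simp [Exp.deg, Reg.val])
  obtain ⟨σe, re, fe, ve⟩ := runs_set_eq hw (a := Reg.lo.addr E)
    (p := .const (-1)) (σ := σd) (v := -1)
    (by simp [Exp.eval]) (by simp [Exp.AtomsLt, l1]) (by simp [Exp.deg])
  obtain ⟨σf, rf, ff, vf⟩ := runs_set_eq hw (a := Reg.hi.addr E)
    (p := .add (.mul (Reg.scale.val E) (.add (Reg.costSum.val E) (.const 1))) (.const 2))
    (σ := σe) (v := I.searchBound)
    (by simp [Exp.eval, Reg.val, fe, fd, vd, vc', Reg.addr_inj, BCInstance.searchBound])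
    (by simp [Exp.eval, Exp.AtomsLt, Reg.val, fe, fd, vd, vc', Reg.addr_inj, h0, l1, l2, cR, qR])
    (by simp [Exp.deg, Reg.val])
  refine ⟨σf, (r₁.seq <| r₂.seq <| r₃.seq <| r₄.seq <| r₅.seq <| r₆.seq <| r₇.seq <| r₈.seq <|
    r₉.seq <| ra.seq <| rb.seq <| rc.seq <| rd.seq <| re.seq rf).mono_time ?_, ?_, ?_, vf, ?_⟩
  · simp [Exp.steps, Reg.val, item]
    omega
  · have hfin : ∀ r : Reg, r ≠ .cnt → r ≠ .feeSum → r ≠ .costSum → r ≠ .scale → r ≠ .lo →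
        r ≠ .hi → σf (r.addr E) = σa (r.addr E) := fun r h1 h2 h3 h4 h5 h6 => by
      simp [ff, fe, fd, fc, fb, Reg.addr_inj, h1, h2, h3, h4, h5, h6]
    have hmid : ∀ r : Reg, r ≠ .cnt → r ≠ .tails → r ≠ .heads → r ≠ .caps → r ≠ .costs →
        r ≠ .fees → σa (r.addr E) = σ₅ (r.addr E) := fun r h1 h2 h3 h4 h5 h6 => by
      simp [fa, f₉, f₈, f₇, f₆, Reg.addr_inj, h1, h2, h3, h4, h5, h6]
    constructor
    · simp [hfin, hmid, f₅, f₄, f₃, f₂, v₁, Reg.addr_inj]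
    · simp [hfin, hmid, f₅, f₄, f₃, v₂, Reg.addr_inj]
    · simp [hfin, hmid, f₅, f₄, v₃, Reg.addr_inj]
    · simp [hfin, hmid, f₅, v₄, Reg.addr_inj]
    · simp [hfin, hmid, v₅]
    · simp [hfin, fa, f₉, f₈, f₇, v₆ y₅.1, Reg.addr_inj]
    · rw [hfin _ (by simp) (by simp) (by simp) (by simp) (by simp) (by simp), ← v₇]
      · simp [fa, f₉, f₈, Reg.addr_inj]
      · simp [f₆, Reg.addr_inj, y₅]
    · simp [hfin, caps]
    · simp [hfin, costs]
    · simp [hfin, fees]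
    · simp [ff, fe, vd, Reg.addr_inj]
  · simp [ff, ve, Reg.addr_inj]
  · simp [ff, fe, fd, fc, fb, fa, f₉, f₈, f₇, f₆, Reg.addr_inj, y₅]

end Scheme

section Search

variable {w : ℕ} {R : ℤ} {E : ℕ}

/-! ### The program: solving the relaxation for one multiplier -/

/-- The program which loads the Lagrangian relaxation for the multiplier `mid / scale` into the
input arrays of the minimum cost flow program. -/
def loadRelaxation (E : ℕ) : Prog :=
  .seq (resetUpTo (E + 7)) <|
  .seq (.assign 0 (.const 0) (Reg.nodes.val E)) <|
  .seq (.assign 0 (.const 1) (Reg.edges.val E)) <|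
  .seq (.assign 0 (.const 2) (Reg.src.val E)) <|
  .seq (.assign 0 (.const 3) (Reg.snk.val E)) <|
  .seq (mapEdges E 1 (item E (Reg.tails.addr E))) <|
  .seq (mapEdges E 2 (item E (Reg.heads.addr E))) <|
  .seq (mapEdges E 3 (item E (Reg.caps.addr E)))
    (mapEdges E 4 (.add (.mul (Reg.scale.val E) (item E (Reg.costs.addr E)))
      (.mul (Reg.mid.val E) (item E (Reg.fees.addr E)))))

/-- After loading, the arrays that the minimum cost flow program may name are exactly its input for
the relaxation. -/
theorem runs_loadRelaxation (hw : Room w R) {I : BCInstance} (hI : I.Small R) {σ : Mem} {p : ℤ}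
    (hσ : Saved I E σ) (hp : σ (Reg.mid.addr E) 0 = p) (hpR : |p| < R) :
    ∃ τ, Runs w (loadRelaxation E) σ ((I.m + 1) * 110 + E) τ ∧
      (∀ r : Reg, r ≠ .cnt → τ (r.addr E) = σ (r.addr E)) ∧
      ∀ a < E + 8, τ a = (I.lagrangian I.scale p).input a := by
  have h0 := hw.pos
  have h8 := hw.1
  have hm := hI.edges
  have l1 : (1 : ℤ) < R := by omega
  have l2 : (2 : ℤ) < R := by omega
  have l3 : (3 : ℤ) < R := by omega
  have eR : ∀ e : Fin I.m, ((e : ℕ) : ℤ) < R := fun e => by have := e.2; omega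
  have qR := hI.scale
  rw [← abs_of_pos I.scale_pos] at qR
  obtain ⟨σ₀, r₀, f₀, v₀⟩ : ∃ τ, Runs w (resetUpTo (E + 7)) σ (E + 8) τ ∧
      (∀ r : Reg, τ (r.addr E) = σ (r.addr E)) ∧ ∀ a < E + 8, τ a = 0 := by
    refine ⟨_, runs_resetUpTo (E + 7) σ, fun r => ?_, fun a ha => ?_⟩
    · have := r.addr_ge E
      exact if_neg (by omega)
    · exact if_pos (by omega)
  have step : ∀ (σ' : Mem) (i : ℤ) (r : Reg), |i| < R → |σ' (r.addr E) 0| < R →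
      Runs w (.assign 0 (.const i) (r.val E)) σ' 4 (write σ' 0 i (σ' (r.addr E) 0)) := by
    intro σ' i r hi hr
    exact Runs.assign (hw.fits (p := .const i) hi (by simp [Exp.deg]))
      (hw.fits (p := r.val E) ⟨by simpa [Exp.AtomsLt] using h0, hr⟩ (by simp [Exp.deg, Reg.val]))
  have step' : ∀ (σ' : Mem) (i v : ℤ) (r : Reg), |i| < R → |v| < R → σ' (r.addr E) 0 = v →
      ∃ τ, Runs w (.assign 0 (.const i) (r.val E)) σ' 4 τ ∧
        (∀ b, b ≠ 0 → τ b = σ' b) ∧ τ 0 = Function.update (σ' 0) i v := by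
    intro σ' i v r hi hv hr
    exact ⟨_, step σ' i r hi (by rwa [hr]), fun b hb => write_of_ne _ _ _ hb,
      by rw [write_same, hr]⟩
  obtain ⟨σ₁, r₁, f₁, v₁⟩ := step' σ₀ 0 I.n .nodes (by simpa using h0) (by simpa using hI.nodes)
    (by rw [f₀, hσ.nodes])
  obtain ⟨σ₂, r₂, f₂, v₂⟩ := step' σ₁ 1 I.m .edges (by simpa using l1) (by simpa using hI.edges)
    (by simp [f₁, Reg.addr_ne_of_lt, f₀, hσ.edges])
  obtain ⟨σ₃, r₃, f₃, v₃⟩ := step' σ₂ 2 (I.source : ℕ) .src (by simpa using l2)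
    (by simpa using hI.src) (by simp [f₁, f₂, Reg.addr_ne_of_lt, f₀, hσ.src])
  obtain ⟨σ₄, r₄, f₄, v₄⟩ := step' σ₃ 3 (I.sink : ℕ) .snk (by simpa using l3)
    (by simpa using hI.snk) (by simp [f₁, f₂, f₃, Reg.addr_ne_of_lt, f₀, hσ.snk])
  have g₄ : ∀ r : Reg, σ₄ (r.addr E) = σ (r.addr E) := fun r => by
    simp [f₁, f₂, f₃, f₄, Reg.addr_ne_of_lt, f₀]
  have k₄ : ∀ a, a ≠ 0 → a < E + 8 → σ₄ a = 0 := fun a ha ha' => by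
    rw [f₄ a ha, f₃ a ha, f₂ a ha, f₁ a ha, v₀ a ha']
  obtain ⟨σ₅, r₅, f₅, -, v₅⟩ := runs_copy (E := E) (σ := σ₄) (src := Reg.tails.addr E) (dst := 1)
    (f := fun e => ((I.tail e : ℕ) : ℤ)) hw hm (by rw [g₄, hσ.edges])
    (Reg.ne_addr_of_lt _ (by simp)) (Reg.ne_addr_of_lt _ (by simp))
    (Reg.addr_ne_of_lt _ (by simp)) (by simp [Reg.addr_inj])
    (fun e => by rw [g₄, hσ.tails]; exact arrayOf_ofFn_natCast _ _)
    (fun e => by simpa using hI.tail e)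
  have g₅ : ∀ r : Reg, r ≠ .cnt → σ₅ (r.addr E) = σ (r.addr E) := fun r hr => by
    rw [f₅ _ (Reg.addr_ne_of_lt _ (by simp)) (by simpa [Reg.addr_inj] using hr), g₄]
  obtain ⟨σ₆, r₆, f₆, -, v₆⟩ := runs_copy (E := E) (σ := σ₅) (src := Reg.heads.addr E) (dst := 2)
    (f := fun e => ((I.head e : ℕ) : ℤ)) hw hm (by rw [g₅ _ (by simp), hσ.edges])
    (Reg.ne_addr_of_lt _ (by simp)) (Reg.ne_addr_of_lt _ (by simp))
    (Reg.addr_ne_of_lt _ (by simp)) (by simp [Reg.addr_inj])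
    (fun e => by rw [g₅ _ (by simp), hσ.heads]; exact arrayOf_ofFn_natCast _ _)
    (fun e => by simpa using hI.head e)
  have g₆ : ∀ r : Reg, r ≠ .cnt → σ₆ (r.addr E) = σ (r.addr E) := fun r hr => by
    rw [f₆ _ (Reg.addr_ne_of_lt _ (by simp)) (by simpa [Reg.addr_inj] using hr), g₅ r hr]
  obtain ⟨σ₇, r₇, f₇, -, v₇⟩ := runs_copy (E := E) (σ := σ₆) (src := Reg.caps.addr E) (dst := 3)
    (f := fun e => (I.cap e : ℤ)) hw hm (by rw [g₆ _ (by simp), hσ.edges])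
    (Reg.ne_addr_of_lt _ (by simp)) (Reg.ne_addr_of_lt _ (by simp))
    (Reg.addr_ne_of_lt _ (by simp)) (by simp [Reg.addr_inj])
    (fun e => by rw [g₆ _ (by simp), hσ.caps]; exact arrayOf_ofFn_natCast _ _)
    (fun e => by simpa using hI.cap e)
  have g₇ : ∀ r : Reg, r ≠ .cnt → σ₇ (r.addr E) = σ (r.addr E) := fun r hr => by
    rw [f₇ _ (Reg.addr_ne_of_lt _ (by simp)) (by simpa [Reg.addr_inj] using hr), g₆ r hr]
  obtain ⟨σ₈, r₈, f₈, -, v₈⟩ := runs_mapEdges_ofFn (E := E) (σ := σ₇) (dst := 4)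
    (p := .add (.mul (Reg.scale.val E) (item E (Reg.costs.addr E)))
      (.mul (Reg.mid.val E) (item E (Reg.fees.addr E))))
    (f := fun e => I.scale * I.cost e + p * (I.fee e : ℤ)) hw hm
    (by rw [g₇ _ (by simp), hσ.edges])
    (Reg.ne_addr_of_lt _ (by simp)) (Reg.ne_addr_of_lt _ (by simp))
    (by simp [Exp.deg, item, Reg.val]) (fun e τ hτ hτc => by
      have ht : ∀ r : Reg, r ≠ .cnt → τ (r.addr E) = σ (r.addr E) := fun r hr => by
        rw [hτ _ (Reg.addr_ne_of_lt _ (by simp)) (by simpa [Reg.addr_inj] using hr), g₇ r hr]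
      simp [item, Reg.val, Exp.eval, Exp.AtomsLt, hτc, ht, hσ.scale, hσ.costs, hσ.fees, hp,
        arrayOf_ofFn_natCast, h0, eR, qR, hpR, hI.cost, hI.fee])
  have g₈ : ∀ r : Reg, r ≠ .cnt → σ₈ (r.addr E) = σ (r.addr E) := fun r hr => by
    rw [f₈ _ (Reg.addr_ne_of_lt _ (by simp)) (by simpa [Reg.addr_inj] using hr), g₇ r hr]
  refine ⟨σ₈, (r₀.seq <| r₁.seq <| r₂.seq <| r₃.seq <| r₄.seq <| r₅.seq <| r₆.seq <|
    r₇.seq r₈).mono_time ?_, g₈, ?_⟩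
  · simp [Exp.steps, Reg.val, item]
    omega
  · have hlow : ∀ a < E + 8, a ≠ Reg.cnt.addr E := fun a ha => by
      have := Reg.cnt.addr_ge E
      omega
    intro a ha
    have hc := hlow a ha
    match a with
    | 0 =>
      rw [f₈ 0 (by simp) hc, f₇ 0 (by simp) hc, f₆ 0 (by simp) hc, f₅ 0 (by simp) hc, v₄, v₃, v₂,
        v₁, v₀ 0 (by omega)]
      exact (arrayOf_four _ _ _ _).symm
    | 1 =>
      rw [f₈ 1 (by simp) hc, f₇ 1 (by simp) hc, f₆ 1 (by simp) hc,
        v₅ (k₄ 1 (by simp) (by omega))]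
      rfl
    | 2 =>
      rw [f₈ 2 (by simp) hc, f₇ 2 (by simp) hc,
        v₆ (by rw [f₅ 2 (by simp) hc, k₄ 2 (by simp) (by omega)])]
      rfl
    | 3 =>
      rw [f₈ 3 (by simp) hc,
        v₇ (by rw [f₆ 3 (by simp) hc, f₅ 3 (by simp) hc, k₄ 3 (by simp) (by omega)])]
      rfl
    | 4 =>
      rw [v₈ (by rw [f₇ 4 (by simp) hc, f₆ 4 (by simp) hc, f₅ 4 (by simp) hc,
        k₄ 4 (by simp) (by omega)])]
      rfl
    | k + 5 =>
      rw [f₈ _ (by omega) hc, f₇ _ (by omega) hc, f₆ _ (by omega) hc, f₅ _ (by omega) hc,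
        k₄ _ (by omega) ha]
      rfl

/-- The minimum cost flow program `A` solves the relaxation for the multiplier `p / scale`, on
words of `w` bits and within `t` steps. -/
def SolvesRelaxation (A : Prog) (w t : ℕ) (I : BCInstance) (p : ℤ) : Prop :=
  ∃ τ, Runs w A (I.lagrangian I.scale p).input t τ ∧
    I.IsLagrangianMin I.scale p fun e => τ 6 ((e : ℕ) : ℤ)

theorem runs_solve (hw : Room w R) {A : Prog} (hA : A.Below (E + 8)) {I : BCInstance}
    (hI : I.Small R) {σ : Mem} {p : ℤ} {t : ℕ} (hσ : Saved I E σ)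
    (hp : σ (Reg.mid.addr E) 0 = p) (hpR : |p| < R) (hsolve : SolvesRelaxation A w t I p) :
    ∃ τ, Runs w (.seq (loadRelaxation E) A) σ ((I.m + 1) * 110 + E + t) τ ∧
      (∀ r : Reg, r ≠ .cnt → τ (r.addr E) = σ (r.addr E)) ∧
      I.IsLagrangianMin I.scale p fun e => τ 6 ((e : ℕ) : ℤ) := by
  obtain ⟨ρ, hρ, hρr, hρi⟩ := runs_loadRelaxation hw hI hσ hp hpR
  obtain ⟨τ, ⟨k, hk, hx⟩, hmin⟩ := hsolve
  -- The memory `ρ` differs from the input of `A` only in arrays that `A` does not name.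
  obtain ⟨τ', hx', hlow, hhigh⟩ := hx.frame hA hρi
  refine ⟨τ', hρ.seq ⟨k, hk, hx'⟩, fun r hr => ?_, ?_⟩
  · rw [hhigh _ (r.addr_ge E), hρr r hr]
  · rwa [hlow 6 (by omega)]

/-! ### The program: the search for the multiplier -/

/-- What the search knows about its bounds `lo` and `hi` and about the flows `x` and `y` that it has
found for them. The initial bounds `-1` and `searchBound` come without minimizers. -/
structure Bracket (I : BCInstance) (lo hi : ℤ) (x y : Fin I.m → ℤ) : Prop where
  neg_one_le : -1 ≤ lo
  lt : lo < hi
  le_searchBound : hi ≤ I.searchBound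
  flow_lo : I.IsFlow fun e => (x e : ℝ)
  flow_hi : I.IsFlow fun e => (y e : ℝ)
  min_lo : lo = -1 ∨ I.IsLagrangianMin I.scale lo x ∧ I.budget < I.intFee x
  min_hi : hi = I.searchBound ∨ I.IsLagrangianMin I.scale hi y ∧ I.intFee y ≤ I.budget

section Bracket

variable {I : BCInstance} {lo hi mid : ℤ} {x y z : Fin I.m → ℤ}

theorem Bracket.initial (I : BCInstance) : Bracket I (-1) I.searchBound 0 0 where
  neg_one_le := le_rfl
  lt := by have := I.two_le_searchBound; omega
  le_searchBound := le_rfl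
  flow_lo := by simpa using I.toMCFInstance.isFlow_zero
  flow_hi := by simpa using I.toMCFInstance.isFlow_zero
  min_lo := .inl rfl
  min_hi := .inl rfl

theorem Bracket.raise (h : Bracket I lo hi x y) (h1 : lo < mid) (h2 : mid < hi)
    (hz : I.IsLagrangianMin I.scale mid z) (hb : I.budget < I.intFee z) :
    Bracket I mid hi z y :=
  { h with
    neg_one_le := h.neg_one_le.trans h1.le
    lt := h2
    flow_lo := hz.1
    min_lo := .inr ⟨hz, hb⟩ }

theorem Bracket.lower (h : Bracket I lo hi x y) (h1 : lo < mid) (h2 : mid < hi)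
    (hz : I.IsLagrangianMin I.scale mid z) (hb : I.intFee z ≤ I.budget) :
    Bracket I lo mid x z :=
  { h with
    lt := h1
    le_searchBound := h2.le.trans h.le_searchBound
    flow_hi := hz.1
    min_hi := .inr ⟨hz, hb⟩ }

/-- When the search ends, the upper bound has been lowered, since close to `searchBound` all
minimizers obey the budget. -/
theorem Bracket.min_hi_of_consecutive (h : Bracket I lo (lo + 1) x y) :
    I.IsLagrangianMin I.scale (lo + 1) y ∧ I.intFee y ≤ I.budget := by
  refine h.min_hi.resolve_left fun hP => ?_
  have h2 := I.two_le_searchBound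
  obtain ⟨hx, hb⟩ := h.min_lo.resolve_left (by omega)
  have := hx.intFee_eq_zero I.scale_pos (by
    have := I.scale_pos
    unfold BCInstance.searchBound at hP
    nlinarith)
  omega

theorem Bracket.isOptimal_of_neg (h : Bracket I lo (lo + 1) x y) (hlo : lo < 0) :
    I.IsOptimal fun e => (y e : ℝ) := by
  obtain rfl : lo = -1 := by have := h.neg_one_le; omega
  obtain ⟨hy, hb⟩ := h.min_hi_of_consecutive
  exact BCInstance.IsLagrangianMin.isOptimal I.scale_pos hy hb

end Bracket

/-- The registers hold the bounds `lo` and `hi` of the search, the flows `x` and `y`, and the fees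
of these flows. -/
structure SearchState (I : BCInstance) (E : ℕ) (σ : Mem) (lo hi : ℤ) (x y : Fin I.m → ℤ) :
    Prop where
  saved : Saved I E σ
  lo : σ (Reg.lo.addr E) 0 = lo
  hi : σ (Reg.hi.addr E) 0 = hi
  feeLo : σ (Reg.feeLo.addr E) 0 = I.intFee x
  feeHi : σ (Reg.feeHi.addr E) 0 = I.intFee y
  flowLo : ∀ e : Fin I.m, σ (Reg.flowLo.addr E) ((e : ℕ) : ℤ) = x e
  flowHi : ∀ e : Fin I.m, σ (Reg.flowHi.addr E) ((e : ℕ) : ℤ) = y e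

/-- The program which replaces one of the bounds of the search by `mid`, together with the flow
for this bound and its fee. -/
def replaceBound (E : ℕ) (bound bfee flow : Reg) : Prog :=
  .seq (set (bound.addr E) (Reg.mid.val E)) <|
  .seq (set (bfee.addr E) (Reg.fee.val E)) (mapEdges E (flow.addr E) (item E 6))

/-- One iteration of the search. -/
def searchStep (E : ℕ) (A : Prog) : Prog :=
  .seq (set (Reg.mid.addr E) (.div (.add (Reg.lo.val E) (Reg.hi.val E)) (.const 2))) <|
  .seq (.seq (loadRelaxation E) A) <|
  .seq (sumEdges E (Reg.fee.addr E) (.mul (item E (Reg.fees.addr E)) (item E 6)))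
    (.ite (.sub (Reg.fee.val E) (Reg.budget.val E))
      (replaceBound E .lo .feeLo .flowLo) (replaceBound E .hi .feeHi .flowHi))

variable {I : BCInstance}

theorem intFlow_abs_lt (hI : I.Small R) {x : Fin I.m → ℤ}
    (hx : I.IsFlow fun e => (x e : ℝ)) (e : Fin I.m) : |x e| < R := by
  rw [abs_of_nonneg (BCInstance.intFlow_nonneg hx e)]
  exact (BCInstance.intFlow_le_cap hx e).trans_lt (hI.cap e)

theorem intFlow_fee_lt (hI : I.Small R) {x : Fin I.m → ℤ}
    (hx : I.IsFlow fun e => (x e : ℝ)) : I.intFee x < R :=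
  (BCInstance.intFlow_fee_le hx).trans_lt hI.feeBound

theorem runs_replaceBound (hw : Room w R) (hI : I.Small R) {σ : Mem} {z : Fin I.m → ℤ} {p : ℤ}
    {bound bfee flow : Reg} (hσ : Saved I E σ) (hpR : |p| < R)
    (hp : σ (Reg.mid.addr E) 0 = p) (hz : I.IsFlow fun e => (z e : ℝ))
    (hb : σ (Reg.fee.addr E) 0 = I.intFee z) (h6 : ∀ e : Fin I.m, σ 6 ((e : ℕ) : ℤ) = z e)
    (h1 : ¬ bound.Permanent) (h2 : ¬ bfee.Permanent) (h3 : ¬ flow.Permanent)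
    (d1 : bound ≠ .fee) (d2 : bound ≠ bfee) (d3 : bound ≠ flow) (d4 : bfee ≠ flow)
    (c1 : bound ≠ .cnt) (c2 : bfee ≠ .cnt) (c3 : flow ≠ .cnt) :
    ∃ τ, Runs w (replaceBound E bound bfee flow) σ ((I.m + 1) * 30) τ ∧
      (∀ r : Reg, r ≠ bound → r ≠ bfee → r ≠ flow → r ≠ .cnt → τ (r.addr E) = σ (r.addr E)) ∧
      τ (bound.addr E) 0 = p ∧ τ (bfee.addr E) 0 = I.intFee z ∧
      ∀ e : Fin I.m, τ (flow.addr E) ((e : ℕ) : ℤ) = z e := by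
  have h0 := hw.pos
  have hfee : |I.intFee z| < R := by
    rw [abs_of_nonneg (BCInstance.intFlow_fee_nonneg hz)]
    exact intFlow_fee_lt hI hz
  have e1 : Reg.edges ≠ bound := by rintro rfl; exact h1 trivial
  have e2 : Reg.edges ≠ bfee := by rintro rfl; exact h2 trivial
  have e3 : Reg.edges ≠ flow := by rintro rfl; exact h3 trivial
  obtain ⟨σ₁, r₁, f₁, v₁⟩ := runs_set_eq hw (a := bound.addr E) (p := Reg.mid.val E) (σ := σ)
    (v := p) (by simp [Reg.val, Exp.eval, hp])
    (by simp [Reg.val, Exp.eval, Exp.AtomsLt, hp, h0, hpR])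
    (by simp [Reg.val, Exp.deg])
  have k₁ : σ₁ (Reg.fee.addr E) 0 = I.intFee z := by
    rw [f₁ _ (by simpa [Reg.addr_inj] using d1.symm), hb]
  obtain ⟨σ₂, r₂, f₂, v₂⟩ := runs_set_eq hw (a := bfee.addr E) (p := Reg.fee.val E) (σ := σ₁)
    (v := I.intFee z) (by simp [Reg.val, Exp.eval, k₁])
    (by simp [Reg.val, Exp.eval, Exp.AtomsLt, k₁, h0, hfee]) (by simp [Reg.val, Exp.deg])
  obtain ⟨σ₃, r₃, f₃, v₃, -⟩ := runs_copy (E := E) (src := 6) (dst := flow.addr E) (f := z)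
    (σ := σ₂) hw hI.edges (by simp [f₂, f₁, Reg.addr_inj, e1, e2, hσ.edges])
    (by simpa [Reg.addr_inj] using c3) (by simpa [Reg.addr_inj] using e3.symm)
    (Reg.ne_addr_of_lt _ (by simp)) (Reg.ne_addr_of_lt _ (by simp))
    (fun e => by simp [f₁, f₂, Reg.ne_addr_of_lt, h6]) (intFlow_abs_lt hI hz)
  refine ⟨σ₃, (r₁.seq <| r₂.seq r₃).mono_time ?_, fun r k1 k2 k3 k4 => ?_, ?_, ?_, v₃⟩
  · simp [Exp.steps, Reg.val]
    omega
  · simp [f₃, f₂, f₁, Reg.addr_inj, k1, k2, k3, k4]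
  · simp [f₃, f₂, v₁, Reg.addr_inj, d2, d3, c1]
  · simp [f₃, v₂, Reg.addr_inj, d4, c2]

theorem runs_searchStep (hw : Room w R) {A : Prog} (hA : A.Below (E + 8)) (hI : I.Small R)
    {t : ℕ} (hsolve : ∀ p, 0 ≤ p → p ≤ I.searchBound → SolvesRelaxation A w t I p)
    {σ : Mem} {lo hi : ℤ} {x y : Fin I.m → ℤ} (hσ : SearchState I E σ lo hi x y)
    (hB : Bracket I lo hi x y) (hgap : lo + 1 < hi) :
    ∃ τ, Runs w (searchStep E A) σ ((I.m + 1) * 200 + E + t) τ ∧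
      ∃ lo' hi' x' y', SearchState I E τ lo' hi' x' y' ∧ Bracket I lo' hi' x' y' ∧
        (lo' = (lo + hi) / 2 ∧ hi' = hi ∨ lo' = lo ∧ hi' = (lo + hi) / 2) := by
  have h0 := hw.pos
  have h8 := hw.1
  have l2 : (2 : ℤ) < R := by omega
  have hlo := hB.neg_one_le
  have hhi := hB.le_searchBound
  have hP := hI.searchBound
  have loR : |lo| < R := abs_lt.2 ⟨by omega, by omega⟩
  have hiR : |hi| < R := abs_lt.2 ⟨by omega, by omega⟩
  obtain ⟨σ₁, r₁, f₁, v₁⟩ := runs_set_eq hw (a := Reg.mid.addr E)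
    (p := .div (.add (Reg.lo.val E) (Reg.hi.val E)) (.const 2)) (σ := σ) (v := (lo + hi) / 2)
    (by simp [Reg.val, Exp.eval, hσ.lo, hσ.hi])
    (by simp [Reg.val, Exp.eval, Exp.AtomsLt, hσ.lo, hσ.hi, h0, l2, loR, hiR])
    (by simp [Reg.val, Exp.deg])
  generalize hmid : (lo + hi) / 2 = mid at *
  have hm1 : lo < mid := by omega
  have hm2 : mid < hi := by omega
  have midR : |mid| < R := abs_lt.2 ⟨by omega, by omega⟩
  have s₁ : Saved I E σ₁ := hσ.saved.congr fun r hr =>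
    f₁ _ (by rw [ne_eq, Reg.addr_inj]; rintro rfl; exact hr)
  obtain ⟨σ₂, r₂, f₂, hz⟩ := runs_solve hw hA hI s₁ v₁ midR (hsolve mid (by omega) (by omega))
  generalize hzdef : (fun e : Fin I.m => σ₂ 6 ((e : ℕ) : ℤ)) = z at hz
  have h6 : ∀ e : Fin I.m, σ₂ 6 ((e : ℕ) : ℤ) = z e := fun e => congrFun hzdef e
  have s₂ : Saved I E σ₂ := s₁.congr fun r hr => f₂ _ (by rintro rfl; exact hr)
  have eR : ∀ e : Fin I.m, ((e : ℕ) : ℤ) < R := fun e => by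
    have := e.2
    have := hI.edges
    omega
  have zR := intFlow_abs_lt hI hz.1
  obtain ⟨σ₃, r₃, f₃, v₃⟩ := runs_sumEdges_fin (acc := Reg.fee.addr E)
    (p := .mul (item E (Reg.fees.addr E)) (item E 6)) (f := fun e => (I.fee e : ℤ) * z e)
    hw hI.edges s₂.edges (by simp [Reg.addr_inj]) (by simp [Reg.addr_inj])
    (by simp [Exp.deg, item, Reg.val])
    (fun e => mul_nonneg (by positivity) (BCInstance.intFlow_nonneg hz.1 e))
    (intFlow_fee_lt hI hz.1) (fun e τ hτ hτc => by
      simp [item, Reg.val, Exp.eval, Exp.AtomsLt, hτc, hτ, Reg.addr_inj, Reg.ne_addr_of_lt,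
        s₂.fees, h6, arrayOf_ofFn_natCast, h0, eR, zR, hI.fee])
  have v₃' : σ₃ (Reg.fee.addr E) 0 = I.intFee z := v₃
  have s₃ : Saved I E σ₃ := s₂.congr fun r hr =>
    f₃ _ (by rw [ne_eq, Reg.addr_inj]; rintro rfl; exact hr)
      (by rw [ne_eq, Reg.addr_inj]; rintro rfl; exact hr)
  have m₃ : σ₃ (Reg.mid.addr E) 0 = mid := by simp [f₃, f₂, v₁, Reg.addr_inj]
  have o₃ : ∀ r : Reg, r ≠ .mid → r ≠ .cnt → r ≠ .fee → σ₃ (r.addr E) = σ (r.addr E) :=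
    fun r h1 h2 h3 => by simp [f₃, f₂, f₁, Reg.addr_inj, h1, h2, h3]
  have h6' : ∀ e : Fin I.m, σ₃ 6 ((e : ℕ) : ℤ) = z e := fun e => by
    simp [f₃, Reg.ne_addr_of_lt, h6]
  have hcond : (Exp.sub (Reg.fee.val E) (Reg.budget.val E)).Fits w σ₃ := by
    refine hw.fits ?_ (by simp [Exp.deg, Reg.val])
    have := intFlow_fee_lt hI hz.1
    simp [Exp.AtomsLt, Reg.val, Exp.eval, v₃', s₃.budget, h0, hI.budget,
      abs_of_nonneg (BCInstance.intFlow_fee_nonneg hz.1), this]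
  have heval : (Exp.sub (Reg.fee.val E) (Reg.budget.val E)).eval σ₃ = I.intFee z - I.budget := by
    simp [Reg.val, Exp.eval, v₃', s₃.budget]
  by_cases hb : I.budget < I.intFee z
  · obtain ⟨τ, r₄, f₄, a₄, b₄, c₄⟩ := runs_replaceBound (bound := .lo) (bfee := .feeLo)
      (flow := .flowLo) hw hI s₃ midR m₃ hz.1 v₃' h6' id id id
      (by simp) (by simp) (by simp) (by simp) (by simp) (by simp) (by simp)
    refine ⟨τ, (r₁.seq <| r₂.seq <| r₃.seq <| Runs.ite_pos hcond (by omega) r₄).mono_time ?_,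
      mid, hi, z, y, ⟨?_, a₄, ?_, b₄, ?_, c₄, ?_⟩, hB.raise hm1 hm2 hz hb, .inl ⟨rfl, rfl⟩⟩
    · simp [Exp.steps, Reg.val, item]
      omega
    · exact s₃.congr fun r hr => f₄ _ (by rintro rfl; exact hr) (by rintro rfl; exact hr)
        (by rintro rfl; exact hr) (by rintro rfl; exact hr)
    · simp [f₄, o₃, hσ.hi]
    · simp [f₄, o₃, hσ.feeHi]
    · simp [f₄, o₃, hσ.flowHi]
  · obtain ⟨τ, r₄, f₄, a₄, b₄, c₄⟩ := runs_replaceBound (bound := .hi) (bfee := .feeHi)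
      (flow := .flowHi) hw hI s₃ midR m₃ hz.1 v₃' h6' id id id
      (by simp) (by simp) (by simp) (by simp) (by simp) (by simp) (by simp)
    refine ⟨τ, (r₁.seq <| r₂.seq <| r₃.seq <| Runs.ite_neg hcond (by omega) r₄).mono_time ?_,
      lo, mid, x, z, ⟨?_, ?_, a₄, ?_, b₄, ?_, c₄⟩, hB.lower hm1 hm2 hz (by omega),
      .inr ⟨rfl, rfl⟩⟩
    · simp [Exp.steps, Reg.val, item]
      omega
    · exact s₃.congr fun r hr => f₄ _ (by rintro rfl; exact hr) (by rintro rfl; exact hr)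
        (by rintro rfl; exact hr) (by rintro rfl; exact hr)
    · simp [f₄, o₃, hσ.lo]
    · simp [f₄, o₃, hσ.feeLo]
    · simp [f₄, o₃, hσ.flowLo]

/-- The binary search for the multiplier. -/
def search (E : ℕ) (A : Prog) : Prog :=
  .loop (.sub (.sub (Reg.hi.val E) (Reg.lo.val E)) (.const 1)) (searchStep E A)

/-- Each iteration halves the gap between the bounds, rounding up. -/
theorem runs_search (hw : Room w R) {A : Prog} (hA : A.Below (E + 8)) (hI : I.Small R)
    {t : ℕ} (hsolve : ∀ p, 0 ≤ p → p ≤ I.searchBound → SolvesRelaxation A w t I p) (d : ℕ) :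
    ∀ {σ : Mem} {lo hi : ℤ} {x y : Fin I.m → ℤ}, SearchState I E σ lo hi x y →
      Bracket I lo hi x y → hi - lo ≤ 2 ^ d →
      ∃ τ, Runs w (search E A) σ (d * ((I.m + 1) * 210 + E + t) + 10) τ ∧
        ∃ lo' x' y', SearchState I E τ lo' (lo' + 1) x' y' ∧ Bracket I lo' (lo' + 1) x' y' := by
  have hcond : ∀ {σ : Mem} {lo hi : ℤ} {x y : Fin I.m → ℤ}, SearchState I E σ lo hi x y →
      Bracket I lo hi x y →
      (Exp.sub (.sub (Reg.hi.val E) (Reg.lo.val E)) (.const 1)).Fits w σ ∧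
      (Exp.sub (.sub (Reg.hi.val E) (Reg.lo.val E)) (.const 1)).eval σ = hi - lo - 1 := by
    intro σ lo hi x y hσ hB
    refine ⟨hw.fits ?_ (by simp [Exp.deg, Reg.val]), by simp [Reg.val, Exp.eval, hσ.hi, hσ.lo]⟩
    have h8 := hw.1
    have h0 := hw.pos
    have h1 := hB.neg_one_le
    have h2 := hB.lt
    have h3 := hB.le_searchBound
    have h4 := hI.searchBound
    have l1 : 1 < R := by omega
    have loR : |lo| < R := abs_lt.2 ⟨by omega, by omega⟩
    have hiR : |hi| < R := abs_lt.2 ⟨by omega, by omega⟩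
    simp [Exp.AtomsLt, Reg.val, Exp.eval, hσ.hi, hσ.lo, h0, l1, loR, hiR]
  have hdone : ∀ {σ : Mem} {lo hi : ℤ} {x y : Fin I.m → ℤ}, SearchState I E σ lo hi x y →
      Bracket I lo hi x y → hi ≤ lo + 1 → ∃ τ, Runs w (search E A) σ 10 τ ∧
        ∃ lo' x' y', SearchState I E τ lo' (lo' + 1) x' y' ∧ Bracket I lo' (lo' + 1) x' y' := by
    intro σ lo hi x y hσ hB hgap
    obtain ⟨hf, he⟩ := hcond hσ hB
    obtain rfl : hi = lo + 1 := by have := hB.lt; omega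
    exact ⟨σ, (Runs.loop_stop hf (by omega)).mono_time (by simp [Exp.steps, Reg.val]), lo, x, y,
      hσ, hB⟩
  induction d with
  | zero =>
    intro σ lo hi x y hσ hB hd
    obtain ⟨τ, hτ, h⟩ := hdone hσ hB (by simpa [add_comm] using hd)
    exact ⟨τ, hτ.mono_time (by omega), h⟩
  | succ d ih =>
    intro σ lo hi x y hσ hB hd
    by_cases hgap : lo + 1 < hi
    · obtain ⟨hf, he⟩ := hcond hσ hB
      obtain ⟨τ, hτ, lo', hi', x', y', hσ', hB', hlohi⟩ :=
        runs_searchStep hw hA hI hsolve hσ hB hgap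
      obtain ⟨τ', hτ', h⟩ := ih hσ' hB' (by rw [pow_succ] at hd; omega)
      refine ⟨τ', (Runs.loop_step hf (by omega) hτ hτ').mono_time ?_, h⟩
      have : (d + 1) * ((I.m + 1) * 210 + E + t) =
          d * ((I.m + 1) * 210 + E + t) + ((I.m + 1) * 210 + E + t) := Nat.succ_mul _ _
      simp only [Exp.steps, Reg.val]
      omega
    · obtain ⟨τ, hτ, h⟩ := hdone hσ hB (by omega)
      exact ⟨τ, hτ.mono_time (by omega), h⟩

/-! ### The program: writing the output -/

/-- The program which writes the optimal combination of the two flows of the search to the output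
arrays. -/
def writeOutput (E : ℕ) : Prog :=
  .seq (.ite (.add (Reg.lo.val E) (.const 1))
    (.seq (set (Reg.wLo.addr E) (.sub (Reg.budget.val E) (Reg.feeHi.val E)))
      (set (Reg.wHi.addr E) (.sub (Reg.feeLo.val E) (Reg.budget.val E))))
    (.seq (set (Reg.wLo.addr E) (.const 0)) (set (Reg.wHi.addr E) (.const 1)))) <|
  .seq (set 7 (.add (Reg.wLo.val E) (Reg.wHi.val E)))
    (mapEdges E 6 (.add (.mul (Reg.wLo.val E) (item E (Reg.flowLo.addr E)))
      (.mul (Reg.wHi.val E) (item E (Reg.flowHi.addr E)))))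

theorem runs_writeOutput (hw : Room w R) (hI : I.Small R)
    (hint : ∀ r s : ℤ, ∃ z, I.IsLagrangianMin r s z)
    {σ : Mem} {lo : ℤ} {x y : Fin I.m → ℤ} (hσ : SearchState I E σ lo (lo + 1) x y)
    (hB : Bracket I lo (lo + 1) x y) :
    ∃ τ, Runs w (writeOutput E) σ ((I.m + 1) * 80) τ ∧ 0 < τ 7 0 ∧
      I.IsOptimal (ratOutput I.m τ) := by
  have h0 := hw.pos
  have h8 := hw.1
  have l1 : 1 < R := by omega
  have hlo := hB.neg_one_le
  have hhi := hB.le_searchBound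
  have hP := hI.searchBound
  have loR : |lo| < R := abs_lt.2 ⟨by omega, by omega⟩
  have xR := intFlow_abs_lt hI hB.flow_lo
  have yR := intFlow_abs_lt hI hB.flow_hi
  have bxR := intFlow_fee_lt hI hB.flow_lo
  have byR := intFlow_fee_lt hI hB.flow_hi
  have bx0 := BCInstance.intFlow_fee_nonneg hB.flow_lo
  have by0 := BCInstance.intFlow_fee_nonneg hB.flow_hi
  have bR := hI.budget
  have eR : ∀ e : Fin I.m, ((e : ℕ) : ℤ) < R := fun e => by
    have := e.2
    have := hI.edges
    omega
  have weights : ∃ (τ : Mem) (a b : ℤ), Runs w (.ite (.add (Reg.lo.val E) (.const 1))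
      (.seq (set (Reg.wLo.addr E) (.sub (Reg.budget.val E) (Reg.feeHi.val E)))
        (set (Reg.wHi.addr E) (.sub (Reg.feeLo.val E) (Reg.budget.val E))))
      (.seq (set (Reg.wLo.addr E) (.const 0)) (set (Reg.wHi.addr E) (.const 1)))) σ 22 τ ∧
      (∀ r : Reg, r ≠ .wLo → r ≠ .wHi → τ (r.addr E) = σ (r.addr E)) ∧
      τ (Reg.wLo.addr E) 0 = a ∧ τ (Reg.wHi.addr E) 0 = b ∧ |a| < R ∧ |b| < R ∧ 0 < a + b ∧
      I.IsOptimal fun e => ((a * x e + b * y e : ℤ) : ℝ) / ((a + b : ℤ) : ℝ) := by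
    have hcond : (Exp.add (Reg.lo.val E) (.const 1)).Fits w σ :=
      hw.fits (by simp [Exp.AtomsLt, Reg.val, Exp.eval, hσ.lo, h0, l1, loR])
        (by simp [Exp.deg, Reg.val])
    have heval : (Exp.add (Reg.lo.val E) (.const 1)).eval σ = lo + 1 := by
      simp [Reg.val, Exp.eval, hσ.lo]
    obtain ⟨hy, hby⟩ := hB.min_hi_of_consecutive
    -- If `lo` has never been raised, then `y` is a minimizer for the multiplier `0`.
    by_cases hneg : lo < 0
    · obtain ⟨σ₁, r₁, f₁, v₁⟩ := runs_set_eq hw (a := Reg.wLo.addr E) (p := .const 0) (σ := σ)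
        (v := 0) rfl (by simpa [Exp.AtomsLt] using h0) (by simp [Exp.deg])
      obtain ⟨σ₂, r₂, f₂, v₂⟩ := runs_set_eq hw (a := Reg.wHi.addr E) (p := .const 1) (σ := σ₁)
        (v := 1) rfl (by simpa [Exp.AtomsLt] using l1) (by simp [Exp.deg])
      refine ⟨σ₂, 0, 1, (Runs.ite_neg hcond (by omega) (r₁.seq r₂)).mono_time ?_, ?_, ?_, v₂, ?_,
        ?_, by norm_num, ?_⟩
      · simp [Exp.steps, Reg.val]
      · intro r h1 h2
        simp [f₂, f₁, Reg.addr_inj, h1, h2]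
      · simp [f₂, v₁, Reg.addr_inj]
      · simpa using h0
      · simpa using l1
      · simpa using hB.isOptimal_of_neg hneg
    · obtain ⟨hx, hbx⟩ := hB.min_lo.resolve_left (by omega)
      obtain ⟨σ₁, r₁, f₁, v₁⟩ := runs_set_eq hw (a := Reg.wLo.addr E)
        (p := .sub (Reg.budget.val E) (Reg.feeHi.val E)) (σ := σ) (v := I.budget - I.intFee y)
        (by simp [Reg.val, Exp.eval, hσ.saved.budget, hσ.feeHi])
        (by simp [Reg.val, Exp.eval, Exp.AtomsLt, hσ.saved.budget, hσ.feeHi, h0, bR, byR,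
          abs_of_nonneg by0])
        (by simp [Reg.val, Exp.deg])
      obtain ⟨σ₂, r₂, f₂, v₂⟩ := runs_set_eq hw (a := Reg.wHi.addr E)
        (p := .sub (Reg.feeLo.val E) (Reg.budget.val E)) (σ := σ₁) (v := I.intFee x - I.budget)
        (by simp [Reg.val, Exp.eval, f₁, Reg.addr_inj, hσ.saved.budget, hσ.feeLo])
        (by simp [Reg.val, Exp.eval, Exp.AtomsLt, f₁, Reg.addr_inj, hσ.saved.budget, hσ.feeLo, h0,
          bR, bxR, abs_of_nonneg bx0])
        (by simp [Reg.val, Exp.deg])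
      refine ⟨σ₂, I.budget - I.intFee y, I.intFee x - I.budget, (Runs.ite_pos hcond (by omega)
        (r₁.seq r₂)).mono_time ?_, ?_, ?_, v₂, abs_lt.2 ⟨by omega, by omega⟩,
        abs_lt.2 ⟨by omega, by omega⟩, by omega, ?_⟩
      · simp [Exp.steps, Reg.val]
      · intro r h1 h2
        simp [f₂, f₁, Reg.addr_inj, h1, h2]
      · simp [f₂, v₁, Reg.addr_inj]
      · have hsum : (I.budget - I.intFee y) + (I.intFee x - I.budget) =
            I.intFee x - I.intFee y := by ring
        rw [hsum]
        refine BCInstance.isOptimal_combo hint (by omega) hx hy ?_ hbx hby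
        unfold BCInstance.scale
        omega
  obtain ⟨σ₁, a, b, r₁, f₁, ha, hb, haR, hbR, hab, hopt⟩ := weights
  obtain ⟨σ₂, r₂, f₂, v₂⟩ := runs_set_eq hw (a := 7) (p := .add (Reg.wLo.val E) (Reg.wHi.val E))
    (σ := σ₁) (v := a + b) (by simp [Reg.val, Exp.eval, ha, hb])
    (by simp [Reg.val, Exp.eval, Exp.AtomsLt, ha, hb, h0, haR, hbR]) (by simp [Reg.val, Exp.deg])
  have k₂ : ∀ r : Reg, σ₂ (r.addr E) = σ₁ (r.addr E) := fun r =>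
    f₂ _ (Reg.addr_ne_of_lt _ (by simp))
  obtain ⟨σ₃, r₃, f₃, v₃, -⟩ := runs_mapEdges_ofFn (E := E) (dst := 6)
    (p := .add (.mul (Reg.wLo.val E) (item E (Reg.flowLo.addr E)))
      (.mul (Reg.wHi.val E) (item E (Reg.flowHi.addr E))))
    (f := fun e => a * x e + b * y e) (σ := σ₂) hw hI.edges
    (by rw [k₂, f₁ _ (by simp) (by simp), hσ.saved.edges])
    (Reg.ne_addr_of_lt _ (by simp)) (Reg.ne_addr_of_lt _ (by simp))
    (by simp [Exp.deg, item, Reg.val]) (fun e τ hτ hτc => by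
      have ht : ∀ r : Reg, r ≠ .cnt → τ (r.addr E) = σ₁ (r.addr E) := fun r hr => by
        rw [hτ _ (Reg.addr_ne_of_lt _ (by simp)) (by simpa [Reg.addr_inj] using hr), k₂]
      simp [item, Reg.val, Exp.eval, Exp.AtomsLt, hτc, ht, f₁, ha, hb, hσ.flowLo, hσ.flowHi,
        h0, eR, haR, hbR, xR, yR])
  have v7 : σ₃ 7 0 = a + b := by
    rw [f₃ 7 (by simp) (Reg.ne_addr_of_lt _ (by simp)), v₂]
  refine ⟨σ₃, (r₁.seq <| r₂.seq r₃).mono_time ?_, by rwa [v7], ?_⟩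
  · simp [Exp.steps, Reg.val, item]
    omega
  · unfold ratOutput
    simpa only [v7, v₃] using hopt

/-! ### The approximation scheme -/

/-- The approximation scheme. It keeps its private arrays above the arrays `0, …, E + 7`, which
contain those that the minimum cost flow program `A` names. -/
def scheme (E : ℕ) (A : Prog) : Prog :=
  .seq (saveInput E) (.seq (search E A) (writeOutput E))

theorem runs_scheme (hw : Room w R) {A : Prog} (hA : A.Below (E + 8)) (hI : I.Small R)
    (hint : ∀ r s : ℤ, ∃ z, I.IsLagrangianMin r s z)
    {t : ℕ} (hsolve : ∀ p, 0 ≤ p → p ≤ I.searchBound → SolvesRelaxation A w t I p) {d : ℕ}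
    (hd : I.searchBound + 1 ≤ 2 ^ d) (ε : ℚ) :
    ∃ τ, Runs w (scheme E A) (I.input ε)
        (d * ((I.m + 1) * 210 + E + t) + (I.m + 1) * 340) τ ∧ 0 < τ 7 0 ∧
      I.IsOptimal (ratOutput I.m τ) := by
  obtain ⟨σ, hσ, hsaved, hlo, hhi, hfl, hfh, hxl, hxh⟩ := runs_saveInput (E := E) hw hI ε
  obtain ⟨ρ, hρ, lo, x, y, hS, hB⟩ := runs_search hw hA hI hsolve d (σ := σ) (x := 0) (y := 0)
    ⟨hsaved, hlo, hhi, by simp [hfl, BCInstance.intFee], by simp [hfh, BCInstance.intFee],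
      by simp [hxl], by simp [hxh]⟩ (Bracket.initial I) (by omega)
  obtain ⟨τ, hτ, hpos, hopt⟩ := runs_writeOutput hw hI hint hS hB
  exact ⟨τ, (hσ.seq (hρ.seq hτ)).mono_time (by omega), hpos, hopt⟩

end Search

/-! ### The sizes of the numbers -/

section Sizes

variable {I : BCInstance}

theorem MCFInstance.maxCost_le {J : MCFInstance} {b : ℕ} (h : ∀ e, |J.cost e| ≤ b) :
    J.maxCost ≤ b :=
  Finset.sup_le fun e _ => by
    have := h e
    rw [← Int.natCast_natAbs] at this
    exact_mod_cast this

theorem BCInstance.nodes_le_maxNum : I.n ≤ I.maxNum :=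
  le_max_of_le_left (le_max_of_le_left (le_max_left _ _))

theorem BCInstance.edges_le_maxNum : I.m ≤ I.maxNum :=
  le_max_of_le_left (le_max_of_le_left (le_max_right _ _))

theorem BCInstance.cost_le_maxNum (e : Fin I.m) : (I.cost e).natAbs ≤ I.maxNum :=
  le_max_of_le_left (le_max_of_le_right (le_max_of_le_left
    (Finset.le_sup (f := fun e => (I.cost e).natAbs) (mem_univ e))))

theorem BCInstance.cap_le_maxNum (e : Fin I.m) : I.cap e ≤ I.maxNum :=
  le_max_of_le_left (le_max_of_le_right (le_max_of_le_right
    (Finset.le_sup (f := fun e => I.cap e) (mem_univ e))))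

theorem BCInstance.fee_le_maxNum (e : Fin I.m) : I.fee e ≤ I.maxNum :=
  le_max_of_le_right (le_max_of_le_left (Finset.le_sup (f := fun e => I.fee e) (mem_univ e)))

theorem BCInstance.budget_le_maxNum : I.budget ≤ I.maxNum :=
  le_max_of_le_right (le_max_right _ _)

theorem BCInstance.one_le_nodes (I : BCInstance) : 1 ≤ I.n := by
  have := I.source.2
  omega

/-- Bounds on the derived numbers in terms of a bound `Y` on the numbers of the instance. Constant
factors are absorbed into powers of `Y ≥ 2`. -/
theorem BCInstance.derived_le {Y : ℤ} (hY : 2 ≤ Y) (h : (I.maxNum : ℤ) ≤ Y) :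
    I.feeBound ≤ Y ^ 3 ∧ I.costBound ≤ Y ^ 4 ∧ I.scale ≤ Y ^ 7 ∧ I.searchBound ≤ Y ^ 13 := by
  have hm : (I.m : ℤ) ≤ Y := le_trans (by exact_mod_cast I.edges_le_maxNum) h
  have hcap : ∀ e, (I.cap e : ℤ) ≤ Y := fun e =>
    le_trans (by exact_mod_cast I.cap_le_maxNum e) h
  have hfee : ∀ e, (I.fee e : ℤ) ≤ Y := fun e =>
    le_trans (by exact_mod_cast I.fee_le_maxNum e) h
  have hcost : ∀ e, |I.cost e| ≤ Y := fun e => by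
    rw [← Int.natCast_natAbs]
    exact le_trans (by exact_mod_cast I.cost_le_maxNum e) h
  have hY0 : 0 ≤ Y := by omega
  have hpow : ∀ k : ℕ, 1 ≤ Y ^ k := fun k => one_le_pow₀ (by omega)
  have h1 : I.feeBound ≤ Y ^ 3 := by
    calc I.feeBound ≤ ∑ _e : Fin I.m, Y * Y :=
          sum_le_sum fun e _ => mul_le_mul (hcap e) (hfee e) (by positivity) hY0
      _ = I.m * (Y * Y) := by simp
      _ ≤ Y * (Y * Y) := mul_le_mul_of_nonneg_right hm (by positivity)
      _ = Y ^ 3 := by ring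
  have h2 : I.costBound ≤ Y ^ 4 := by
    calc I.costBound ≤ ∑ _e : Fin I.m, Y * (Y * Y) :=
          sum_le_sum fun e _ => mul_le_mul (hcap e)
            (by
              rw [← abs_mul_abs_self]
              exact mul_le_mul (hcost e) (hcost e) (abs_nonneg _) hY0)
            (mul_self_nonneg _) hY0
      _ = I.m * (Y * (Y * Y)) := by simp
      _ ≤ Y * (Y * (Y * Y)) := mul_le_mul_of_nonneg_right hm (by positivity)
      _ = Y ^ 4 := by ring
  have h3 : I.scale ≤ Y ^ 7 := by
    calc I.scale ≤ Y ^ 3 * Y ^ 3 + 1 := by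
          have := mul_le_mul h1 h1 I.feeBound_nonneg (by positivity)
          unfold scale
          omega
      _ ≤ 2 * Y ^ 6 := by have := hpow 6; nlinarith
      _ ≤ Y * Y ^ 6 := mul_le_mul_of_nonneg_right hY (by positivity)
      _ = Y ^ 7 := by ring
  refine ⟨h1, h2, h3, ?_⟩
  have h4 : I.costBound + 1 ≤ Y ^ 5 := by
    have := mul_le_mul_of_nonneg_right hY (by positivity : 0 ≤ Y ^ 4)
    have := hpow 4
    have : Y ^ 5 = Y * Y ^ 4 := by ring
    omega
  have h5 : I.scale * (I.costBound + 1) ≤ Y ^ 7 * Y ^ 5 :=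
    mul_le_mul h3 h4 (by have := I.costBound_nonneg; omega) (by positivity)
  have h6 := mul_le_mul_of_nonneg_right hY (by positivity : 0 ≤ Y ^ 12)
  have h7 : 2 ≤ Y ^ 12 := hY.trans (le_self_pow₀ (by omega) (by norm_num))
  have e1 : Y ^ 7 * Y ^ 5 = Y ^ 12 := by ring
  have e2 : Y ^ 13 = Y * Y ^ 12 := by ring
  unfold searchBound
  omega

variable {s : ℕ}

theorem BCInstance.two_le_two_pow_of_maxNum_lt (h : I.maxNum < 2 ^ s) : (2 : ℤ) ≤ 2 ^ s := by
  have h1 := I.one_le_nodes.trans I.nodes_le_maxNum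
  have h2 : 2 ≤ 2 ^ s := by omega
  exact_mod_cast h2

/-- For an instance whose numbers have at most `s` bits, `16 s` bits suffice for all the numbers
that the approximation scheme stores. -/
theorem BCInstance.small_of_maxNum_lt (h : I.maxNum < 2 ^ s) : I.Small (2 ^ (16 * s)) := by
  have hY := I.two_le_two_pow_of_maxNum_lt h
  have hM : (I.maxNum : ℤ) < 2 ^ s := by exact_mod_cast h
  rw [mul_comm, pow_mul]
  set Y : ℤ := 2 ^ s
  obtain ⟨h1, h2, h3, h4⟩ := I.derived_le hY hM.le
  have hlt : ∀ {k : ℕ}, k < 16 → Y ^ k < Y ^ 16 := fun hk => pow_lt_pow_right₀ (by omega) hk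
  have hle : ∀ {a : ℕ}, a ≤ I.maxNum → (a : ℤ) < Y ^ 16 := fun {a} ha => by
    have h5 : (a : ℤ) ≤ I.maxNum := by exact_mod_cast ha
    have h6 : Y ≤ Y ^ 16 := le_self_pow₀ (by omega) (by norm_num)
    omega
  exact
    { nodes := hle I.nodes_le_maxNum
      edges := hle I.edges_le_maxNum
      cap := fun e => hle (I.cap_le_maxNum e)
      cost := fun e => by
        rw [← Int.natCast_natAbs]
        exact hle (I.cost_le_maxNum e)
      fee := fun e => hle (I.fee_le_maxNum e)
      budget := hle I.budget_le_maxNum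
      feeBound := h1.trans_lt (hlt (by norm_num))
      costBound := h2.trans_lt (hlt (by norm_num))
      scale := h3.trans_lt (hlt (by norm_num))
      searchBound := h4.trans_lt (hlt (by norm_num)) }

theorem BCInstance.abs_cost_lagrangian_lt (h : I.maxNum < 2 ^ s) {p : ℤ} (hp : 0 ≤ p)
    (hpP : p ≤ I.searchBound) (e : Fin I.m) :
    |(I.lagrangian I.scale p).cost e| < 2 ^ (16 * s) := by
  have hY := I.two_le_two_pow_of_maxNum_lt h
  have hM : (I.maxNum : ℤ) < 2 ^ s := by exact_mod_cast h
  rw [mul_comm, pow_mul]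
  set Y : ℤ := 2 ^ s
  obtain ⟨-, -, h3, h4⟩ := I.derived_le hY hM.le
  have hfee : (I.fee e : ℤ) ≤ Y := le_trans (by exact_mod_cast I.fee_le_maxNum e) hM.le
  have hcost : |I.cost e| ≤ Y := by
    rw [← Int.natCast_natAbs]
    exact le_trans (by exact_mod_cast I.cost_le_maxNum e) hM.le
  have hY0 : 0 < Y := by omega
  calc |I.scale * I.cost e + p * (I.fee e : ℤ)|
      ≤ |I.scale * I.cost e| + |p * (I.fee e : ℤ)| := abs_add_le _ _
    _ = I.scale * |I.cost e| + p * I.fee e := by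
        rw [abs_mul, abs_of_pos I.scale_pos, abs_of_nonneg (by positivity : 0 ≤ p * (I.fee e : ℤ))]
    _ ≤ Y ^ 7 * Y + Y ^ 13 * Y :=
        add_le_add (mul_le_mul h3 hcost (abs_nonneg _) (by positivity))
          (mul_le_mul (hpP.trans h4) hfee (by positivity) (by positivity))
    _ ≤ 2 * Y ^ 14 := by
        have : Y ^ 8 ≤ Y ^ 14 := pow_le_pow_right₀ (by omega) (by norm_num)
        have e1 : Y ^ 7 * Y = Y ^ 8 := by ring
        have e2 : Y ^ 13 * Y = Y ^ 14 := by ring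
        omega
    _ ≤ Y * Y ^ 14 := mul_le_mul_of_nonneg_right hY (by positivity)
    _ = Y ^ 15 := by ring
    _ < Y ^ 16 := pow_lt_pow_right₀ (by omega) (by norm_num)

end Sizes

/-! ### Running times -/

variable {A : Prog} {T : ℕ → ℕ → ℕ → ℕ → ℝ}

theorem SolvesMCF.exists_isLagrangianMin (hA : SolvesMCF A T) (I : BCInstance) (r s : ℤ) :
    ∃ z, I.IsLagrangianMin r s z := by
  obtain ⟨κ, hκ⟩ := hA
  obtain ⟨k, τ, -, -, h⟩ := hκ (I.lagrangian r s) _ _ le_rfl le_rfl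
  exact ⟨fun e => τ 6 ((e : ℕ) : ℤ), h⟩

theorem SolvesMCF.nodes_add_edges_le (hA : SolvesMCF A T) (I : MCFInstance) {C U : ℕ}
    (hC : I.maxCost ≤ C) (hU : I.maxCap ≤ U) : ((I.n + I.m : ℕ) : ℝ) ≤ T I.m I.n C U := by
  obtain ⟨κ, hκ⟩ := hA
  obtain ⟨k, τ, -, h, -⟩ := hκ I C U hC hU
  refine le_trans ?_ h
  exact_mod_cast Nat.le_add_right _ _

/-- With `s` the binary length of the numbers of the instance, the costs of all relaxations are at
most `C ^ (16 s)`, and their binary lengths are at most `16 s`. -/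
theorem SolvesMCF.solvesRelaxation (hA : SolvesMCF A T) :
    ∃ κ : ℕ, ∀ (I : BCInstance) (C U s : ℕ), 2 ≤ C → I.maxCap ≤ U → I.maxNum < 2 ^ s →
      ∀ p, 0 ≤ p → p ≤ I.searchBound →
      SolvesRelaxation A (κ * s) ⌊T I.m I.n (C ^ (16 * s)) U⌋₊ I p := by
  obtain ⟨κ, hκ⟩ := hA
  refine ⟨κ * 16, fun I C U s hC hU hs p hp hpP => ?_⟩
  have hcost : (I.lagrangian I.scale p).maxCost ≤ 2 ^ (16 * s) - 1 := by
    refine MCFInstance.maxCost_le fun e => ?_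
    have h1 := I.abs_cost_lagrangian_lt hs hp hpP e
    have h2 : 1 ≤ 2 ^ (16 * s) := Nat.one_le_two_pow
    have h3 : ((2 ^ (16 * s) - 1 : ℕ) : ℤ) = 2 ^ (16 * s) - 1 := by
      rw [Nat.cast_sub h2]
      simp
    rw [h3]
    omega
  have hpos : 0 < 2 ^ (16 * s) := by positivity
  obtain ⟨k, τ, hx, ht, hmin⟩ := hκ (I.lagrangian I.scale p) (C ^ (16 * s)) U
    (hcost.trans ((Nat.sub_le _ _).trans (Nat.pow_le_pow_left hC _))) hU
  have hs16 : 2 ^ s ≤ 2 ^ (16 * s) := Nat.pow_le_pow_right (by norm_num) (by omega)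
  have hnum : (I.lagrangian I.scale p).maxNum < 2 ^ (16 * s) := by
    have h1 : I.n ≤ I.maxNum := I.nodes_le_maxNum
    have h2 : I.m ≤ I.maxNum := I.edges_le_maxNum
    have h3 : I.maxCap ≤ I.maxNum := Finset.sup_le fun e _ => I.cap_le_maxNum e
    refine max_lt (max_lt (by simp only; omega) (by simp only; omega)) (max_lt (by omega) ?_)
    exact lt_of_le_of_lt h3 (by omega)
  refine ⟨τ, ⟨k, Nat.le_floor (le_trans ?_ ht), hx.mono ?_⟩, hmin⟩
  · exact_mod_cast Nat.le_add_left _ _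
  · rw [mul_assoc]
    exact Nat.mul_le_mul_left κ (Nat.size_le.2 hnum)

theorem BCInstance.IsOptimal.totalCost_nonpos {I : BCInstance} {x : Fin I.m → ℝ}
    (h : I.IsOptimal x) : I.totalCost x ≤ 0 := by
  refine (h.2 (fun _ => 0) ⟨I.toMCFInstance.isFlow_zero, ?_⟩).trans (le_of_eq ?_)
  · simp [totalFee]
  · simp [MCFInstance.totalCost]

/-- The running time of the scheme in terms of the binary length of the numbers. -/
theorem exists_scheme (hA : SolvesMCF A T) :
    ∃ (Q : Prog) (c : ℕ), ∀ (I : BCInstance) (ε : ℚ) (C U : ℕ), 0 < ε →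
      2 ≤ C → I.maxCost ≤ C → I.maxCap ≤ U →
      ApproximatesWithin Q c I ε
        (c * Nat.size I.maxNum * T I.m I.n (C ^ (16 * Nat.size I.maxNum)) U) := by
  obtain ⟨E, hE⟩ := A.exists_below
  obtain ⟨κ, hκ⟩ := hA.solvesRelaxation
  -- Expressions of degree `4` in numbers of `16 s` bits need `64 s` bits, and `A` needs `κ s` bits.
  -- The remaining summand is the constant of the running time with `d = 16 s` iterations.
  refine ⟨scheme E A, 64 + κ + (16 * (211 + E) + 341), fun I ε C U hε hC hcost hcap => ?_⟩
  set s := Nat.size I.maxNum with hs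
  have hnum : I.maxNum < 2 ^ s := Nat.lt_size_self _
  have hs1 : 1 ≤ s := by
    have h1 := I.one_le_nodes.trans I.nodes_le_maxNum
    by_contra h
    obtain h0 : s = 0 := by omega
    rw [h0] at hnum
    omega
  have hroom : Room ((64 + κ) * s) (2 ^ (16 * s)) := by
    constructor
    · calc (8 : ℤ) = 2 ^ 3 := by norm_num
        _ ≤ 2 ^ (16 * s) := pow_le_pow_right₀ (by norm_num) (by omega)
    · rw [← pow_mul]
      exact pow_le_pow_right₀ (by norm_num) (by nlinarith)
  set t := ⌊T I.m I.n (C ^ (16 * s)) U⌋₊ with ht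
  have hmn : ((I.n + I.m : ℕ) : ℝ) ≤ T I.m I.n (C ^ (16 * s)) U :=
    hA.nodes_add_edges_le I.toMCFInstance
      (hcost.trans (Nat.le_self_pow (by omega) C)) hcap
  have hmnt : I.n + I.m ≤ t := Nat.le_floor hmn
  have htT : (t : ℝ) ≤ T I.m I.n (C ^ (16 * s)) U := Nat.floor_le ((Nat.cast_nonneg _).trans hmn)
  obtain ⟨τ, ⟨k, hk, hx⟩, hpos, hopt⟩ := runs_scheme hroom (hE.mono (Nat.le_add_right E 8))
    (I.small_of_maxNum_lt hnum) (hA.exists_isLagrangianMin I)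
    (t := t) (d := 16 * s) (fun p hp hpP =>
      let ⟨τ, ⟨k, hk, hx⟩, hmin⟩ := hκ I C U s hC hcap hnum p hp hpP
      ⟨τ, ⟨k, hk, hx.mono (Nat.mul_le_mul_right s (by omega))⟩, hmin⟩)
    (by have := (I.small_of_maxNum_lt hnum).searchBound; omega) ε
  refine ⟨k, τ, hx.mono ?_, ?_, hpos, hopt.1, _, hopt, ?_⟩
  · exact Nat.mul_le_mul (Nat.le_add_right _ _) (Nat.size_le_size (Nat.le_add_right _ _))
  · have hn := I.one_le_nodes
    have hm1 : I.m + 1 ≤ t := by omega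
    have ht1 : 1 ≤ t := by omega
    have hst : t ≤ s * t := Nat.le_mul_of_pos_left t hs1
    have h1 : (I.m + 1) * 210 + E + t ≤ (211 + E) * t := by nlinarith
    have h2 : 16 * s * ((I.m + 1) * 210 + E + t) ≤ 16 * s * ((211 + E) * t) :=
      Nat.mul_le_mul_left _ h1
    have h3 : I.n + I.m + k ≤ (16 * (211 + E) + 341) * s * t := by nlinarith
    have h4 : (16 * (211 + E) + 341) * s * t ≤ (64 + κ + (16 * (211 + E) + 341)) * s * t :=
      Nat.mul_le_mul_right _ (Nat.mul_le_mul_right _ (Nat.le_add_left _ _))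
    calc ((I.n + I.m + k : ℕ) : ℝ)
        ≤ (((64 + κ + (16 * (211 + E) + 341)) * s * t : ℕ) : ℝ) := by
          exact_mod_cast h3.trans h4
      _ = ((64 + κ + (16 * (211 + E) + 341) : ℕ) : ℝ) * s * t := by push_cast; ring
      _ ≤ _ := mul_le_mul_of_nonneg_left htT (by positivity)
  · have h0 := hopt.totalCost_nonpos
    have hε' : (0 : ℝ) < ε := by exact_mod_cast hε
    nlinarith

theorem ApproximatesWithin.mono {Q : Prog} {K K' : ℕ} {I : BCInstance} {ε : ℚ} {t t' : ℝ}
    (h : ApproximatesWithin Q K I ε t) (hK : K ≤ K') (ht : t ≤ t') :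
    ApproximatesWithin Q K' I ε t' := by
  obtain ⟨k, τ, hx, hk, h⟩ := h
  exact ⟨k, τ, hx.mono (Nat.mul_le_mul_right _ hK), hk.trans ht, h⟩

theorem size_le_three_mul_log {N M : ℕ} (hM : 2 ≤ M) (hN : N ≤ M) :
    (Nat.size N : ℝ) ≤ 3 * Real.log M := by
  have h2 : Real.log 2 ≤ Real.log M := Real.log_le_log (by norm_num) (by exact_mod_cast hM)
  have h3 := Real.log_two_gt_d9
  rcases Nat.eq_zero_or_pos (Nat.size N) with h | h
  · rw [h, Nat.cast_zero]
    linarith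
  · have h4 : 2 ^ (Nat.size N - 1) ≤ M := (Nat.lt_size.1 (by omega)).trans hN
    have h5 : ((Nat.size N - 1 : ℕ) : ℝ) * Real.log 2 ≤ Real.log M := by
      rw [← Real.log_pow]
      exact Real.log_le_log (by positivity) (by exact_mod_cast h4)
    have h6 : (Nat.size N : ℝ) = ((Nat.size N - 1 : ℕ) : ℝ) + 1 := by
      rw [Nat.cast_sub h]
      simp
    have h7 : (0 : ℝ) ≤ ((Nat.size N - 1 : ℕ) : ℝ) := Nat.cast_nonneg _
    nlinarith

theorem exists_runsInBigO (hA : SolvesMCF A T) (hlog : AtMostLinearInLogCost T) :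
    ∃ Q : Prog, RunsInBigO Q fun I ε M C U =>
      (Real.log (M : ℝ) / (ε : ℝ)) ^ 2 * T I.m I.n C U := by
  obtain ⟨Q, c, hQ⟩ := exists_scheme hA
  obtain ⟨K₀, hK₀⟩ := hlog
  -- The factor `144 = 16 * 9` stems from the exponent `16 s` and from `s ≤ 3 log M`.
  refine ⟨Q, max c ⌈c * 144 * |K₀|⌉₊, fun I ε M C U hε hε1 hM hIM hC hcost hcap => ?_⟩
  refine (hQ I ε C U hε hC hcost hcap).mono (le_max_left _ _) ?_
  set s := Nat.size I.maxNum
  set L := Real.log M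
  have hs : (s : ℝ) ≤ 3 * L := size_le_three_mul_log hM hIM
  have hs0 : (0 : ℝ) ≤ s := Nat.cast_nonneg _
  have hs1 : 1 ≤ s := by
    have h1 := I.one_le_nodes.trans I.nodes_le_maxNum
    exact Nat.size_pos.2 h1
  have hT : 0 ≤ T I.m I.n C U :=
    (Nat.cast_nonneg _).trans (hA.nodes_add_edges_le I.toMCFInstance hcost hcap)
  have h1 : T I.m I.n (C ^ (16 * s)) U ≤ |K₀| * (16 * s) * T I.m I.n C U := by
    refine (hK₀ I.m I.n C U (16 * s) hC (by omega)).trans ?_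
    push_cast
    exact mul_le_mul_of_nonneg_right
      (mul_le_mul_of_nonneg_right (le_abs_self _) (by positivity)) hT
  have hε0 : (0 : ℝ) < ε := by exact_mod_cast hε
  have hε1' : (ε : ℝ) ≤ 1 := by exact_mod_cast hε1.le
  have hL : L ≤ L / ε := le_div_self (by linarith) hε0 hε1'
  have hL2 : (s : ℝ) * s ≤ 9 * (L / ε) ^ 2 := by nlinarith
  have hceil : (c : ℝ) * 144 * |K₀| ≤ ((max c ⌈c * 144 * |K₀|⌉₊ : ℕ) : ℝ) :=
    (Nat.le_ceil _).trans (by exact_mod_cast le_max_right _ _)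
  calc (c : ℝ) * s * T I.m I.n (C ^ (16 * s)) U
      ≤ c * s * (|K₀| * (16 * s) * T I.m I.n C U) := mul_le_mul_of_nonneg_left h1 (by positivity)
    _ = c * 16 * |K₀| * T I.m I.n C U * (s * s) := by ring
    _ ≤ c * 16 * |K₀| * T I.m I.n C U * (9 * (L / ε) ^ 2) :=
        mul_le_mul_of_nonneg_left hL2 (by positivity)
    _ = c * 144 * |K₀| * ((L / ε) ^ 2 * T I.m I.n C U) := by ring
    _ ≤ _ := mul_le_mul_of_nonneg_right hceil (by positivity)

/-! ### Polynomiality in the encoding size -/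

section EncodingSize

variable (I : BCInstance)

theorem size_le_self (n : ℕ) : Nat.size n ≤ n := Nat.size_le.2 Nat.lt_two_pow_self

theorem size_max (a b : ℕ) : Nat.size (max a b) = max (Nat.size a) (Nat.size b) :=
  Monotone.map_max fun _ _ => Nat.size_le_size

theorem size_sup_le {ι : Type*} (s : Finset ι) (f : ι → ℕ) {b : ℕ}
    (h : ∀ i ∈ s, Nat.size (f i) ≤ b) : Nat.size (s.sup f) ≤ b :=
  Nat.size_le.2 ((Finset.sup_lt_iff (by positivity)).2 fun i hi => Nat.size_le.1 (h i hi))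

theorem BCInstance.edge_size_le (e : Fin I.m) :
    1 + Nat.size (I.tail e) + Nat.size (I.head e) + Nat.size (I.cap e) +
      Nat.size (I.cost e).natAbs + Nat.size (I.fee e) ≤ I.encodingSize := by
  unfold encodingSize
  exact le_add_left (Finset.single_le_sum (f := fun e => 1 + Nat.size (I.tail e) +
    Nat.size (I.head e) + Nat.size (I.cap e) + Nat.size (I.cost e).natAbs + Nat.size (I.fee e))
    (fun _ _ => Nat.zero_le _) (mem_univ e))

theorem BCInstance.nodes_le_encodingSize : I.n ≤ I.encodingSize := by
  unfold encodingSize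
  omega

theorem BCInstance.edges_le_encodingSize : I.m ≤ I.encodingSize := by
  unfold encodingSize
  refine le_add_left ?_
  calc I.m = ∑ _e : Fin I.m, 1 := by simp
    _ ≤ _ := sum_le_sum fun e _ => by omega

theorem BCInstance.size_maxCost_le : Nat.size I.maxCost ≤ I.encodingSize :=
  size_sup_le _ _ fun e _ => by have := I.edge_size_le e; omega

theorem BCInstance.size_maxCap_le : Nat.size I.maxCap ≤ I.encodingSize :=
  size_sup_le _ _ fun e _ => by have := I.edge_size_le e; omega

theorem BCInstance.size_maxFee_le : Nat.size I.maxFee ≤ I.encodingSize :=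
  size_sup_le _ _ fun e _ => by have := I.edge_size_le e; omega

theorem BCInstance.size_maxNum_le : Nat.size I.maxNum ≤ I.encodingSize := by
  unfold maxNum MCFInstance.maxNum
  simp only [size_max]
  have h1 : Nat.size I.budget ≤ I.encodingSize := by
    unfold encodingSize
    omega
  exact max_le (max_le (max_le ((size_le_self _).trans I.nodes_le_encodingSize)
    ((size_le_self _).trans I.edges_le_encodingSize))
    (max_le I.size_maxCost_le I.size_maxCap_le)) (max_le I.size_maxFee_le h1)

end EncodingSize

theorem log_le_size (n : ℕ) : Real.log n ≤ Nat.size n := by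
  rcases Nat.eq_zero_or_pos n with rfl | h
  · simp
  · have h1 : (n : ℝ) ≤ 2 ^ Nat.size n := by exact_mod_cast (Nat.lt_size_self n).le
    have h2 : Real.log n ≤ Nat.size n * Real.log 2 := by
      rw [← Real.log_pow]
      exact Real.log_le_log (by exact_mod_cast h) h1
    have h3 := Real.log_two_lt_d9
    have h4 : (0 : ℝ) ≤ Nat.size n := Nat.cast_nonneg _
    nlinarith

/-- The running time is polynomial in `|I|` and `1 / ε`, since `log M` and the contributions of
`m`, `n`, `C` and `U` to the polynomial bound are at most linear in the encoding size. -/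
theorem RunsInBigO.isFPTAS {Q : Prog} (hA : SolvesMCF A T) (hpoly : PolynomiallyBounded T)
    (hQ : RunsInBigO Q fun I ε M C U => (Real.log (M : ℝ) / (ε : ℝ)) ^ 2 * T I.m I.n C U) :
    IsFPTAS Q := by
  obtain ⟨K, hK⟩ := hQ
  obtain ⟨d, hd⟩ := hpoly
  -- With `X = |I| + 1 / ε`, the square of `log M / ε` is at most `9 X ^ 4`, and the base of the
  -- polynomial bound is at most `7 X`; the summand `d + 4` is the degree.
  refine ⟨K, K * 9 * d * 7 ^ d + (d + 4), fun I ε hε hε1 => ?_⟩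
  have hcost : I.maxCost ≤ max 2 I.maxCost := le_max_right _ _
  refine (hK I ε (max 2 I.maxNum) (max 2 I.maxCost) I.maxCap hε hε1 (le_max_left _ _)
    (le_max_right _ _) (le_max_left _ _) hcost le_rfl).mono le_rfl ?_
  have hε0 : (0 : ℝ) < ε := by exact_mod_cast hε
  have hε1' : (ε : ℝ) ≤ 1 := by exact_mod_cast hε1.le
  set X : ℝ := (I.encodingSize : ℝ) + 1 / ε
  have hinv : 1 ≤ 1 / (ε : ℝ) := by rwa [le_div_iff₀ hε0, one_mul]
  have henc : (0 : ℝ) ≤ I.encodingSize := Nat.cast_nonneg _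
  have hX1 : 1 ≤ X := by simp only [X]; linarith
  have hX0 : 0 ≤ X := by linarith
  have hle : ∀ {a : ℕ}, a ≤ I.encodingSize → (a : ℝ) ≤ X := fun {a} ha => by
    have : (a : ℝ) ≤ I.encodingSize := by exact_mod_cast ha
    simp only [X]
    linarith
  have hsize2 : ∀ {a : ℕ}, Nat.size a ≤ I.encodingSize → (Nat.size (max 2 a) : ℝ) ≤ 3 * X := by
    intro a ha
    have h1 : Nat.size (max 2 a) ≤ 2 + Nat.size a := by
      rw [size_max]
      exact max_le ((size_le_self 2).trans (by omega)) (by omega)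
    have h2 : (Nat.size (max 2 a) : ℝ) ≤ 2 + Nat.size a := by exact_mod_cast h1
    have := hle ha
    linarith
  have hlog : Real.log ((max 2 I.maxNum : ℕ) : ℝ) ≤ 3 * X :=
    (log_le_size _).trans (hsize2 I.size_maxNum_le)
  have hlog0 : 0 ≤ Real.log ((max 2 I.maxNum : ℕ) : ℝ) := Real.log_natCast_nonneg _
  have hdiv : Real.log ((max 2 I.maxNum : ℕ) : ℝ) / ε ≤ 3 * X * X := by
    rw [div_eq_mul_one_div]
    exact mul_le_mul hlog (by simp only [X]; linarith) (by positivity) (by positivity)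
  have hsq : (Real.log ((max 2 I.maxNum : ℕ) : ℝ) / ε) ^ 2 ≤ (3 * X * X) ^ 2 :=
    pow_le_pow_left₀ (by positivity) hdiv 2
  have hT0 : 0 ≤ T I.m I.n (max 2 I.maxCost) I.maxCap :=
    (Nat.cast_nonneg _).trans (hA.nodes_add_edges_le I.toMCFInstance hcost le_rfl)
  have hT : T I.m I.n (max 2 I.maxCost) I.maxCap ≤ d * (7 * X) ^ d := by
    refine (hd _ _ _ _).trans ?_
    push_cast
    refine mul_le_mul_of_nonneg_left (pow_le_pow_left₀ (by positivity) ?_ d) (by positivity)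
    have h1 := hle I.edges_le_encodingSize
    have h2 := hle I.nodes_le_encodingSize
    have h3 := hsize2 I.size_maxCost_le
    have h4 := hle I.size_maxCap_le
    linarith
  have hbase : ((K * 9 * d * 7 ^ d : ℕ) : ℝ) ≤ ((K * 9 * d * 7 ^ d + (d + 4) : ℕ) : ℝ) := by
    exact_mod_cast Nat.le_add_right _ _
  calc (K : ℝ) * ((Real.log ((max 2 I.maxNum : ℕ) : ℝ) / ε) ^ 2 *
        T I.m I.n (max 2 I.maxCost) I.maxCap)
      ≤ K * ((3 * X * X) ^ 2 * (d * (7 * X) ^ d)) :=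
        mul_le_mul_of_nonneg_left (mul_le_mul hsq hT hT0 (by positivity)) (by positivity)
    _ = ((K * 9 * d * 7 ^ d : ℕ) : ℝ) * X ^ (d + 4) := by
        push_cast
        rw [mul_pow 7 X d, pow_add]
        ring
    _ ≤ ((K * 9 * d * 7 ^ d + (d + 4) : ℕ) : ℝ) * X ^ (K * 9 * d * 7 ^ d + (d + 4)) :=
        mul_le_mul hbase (pow_le_pow_right₀ hX1 (Nat.le_add_left _ _)) (by positivity)
          (by positivity)

end BCFlow

theorem mainTheorem3 (A : Prog) (MCF : ℕ → ℕ → ℕ → ℕ → ℝ)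
    (hA : SolvesMCF A MCF) (hpoly : PolynomiallyBounded MCF)
    (hlog : AtMostLinearInLogCost MCF) :
    ∃ Q : Prog, IsFPTAS Q ∧
      RunsInBigO Q (fun I ε M C U =>
        (Real.log (M : ℝ) / (ε : ℝ)) ^ 2 * MCF I.m I.n C U) := by
  obtain ⟨Q, hQ⟩ := exists_runsInBigO hA hlog
  exact ⟨Q, hQ.isFPTAS hA hpoly, hQ⟩
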